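/- **Setting.** Let $\mathcal M$ be a $C^*$-algebra and $E$ a $C^*$-correspondence over $\mathcal M$: a (complete) right Hilbert $\mathcal M$-module with inner product $\langle\cdot,\cdot\rangle$, linear in the second variable, together with a left action $a\xi:=\phi(a)\xi$ given by a non-zero $*$-homomorphism $\phi:\mathcal M\to\mathcal L(E)$ into the adjointable operators that is essential, i.e. the closed linear span of $\phi(\mathcal M)E$ is $E$. Assume moreover that $\phi$ remains essential on the ideal generated by the inner products of $E$, i.e. $$\overline{\operatorname{span}}\{\phi(\langle\xi,\eta\rangle)\zeta:\ \xi,\eta,\zeta\in E\}=E ;$$ this is automatic when $E$ is full. Let $(\sigma,T)$ be a completely bounded covariant representation of $E$ on a Hilbert space $\mathcal H$: $\sigma:\mathcal M\to B(\mathcal H)$ is an essential (nondegenerate) $*$-representation, $T:E\to B(\mathcal H)$ is linear and completely bounded, and $T(a\xi b)=\sigma(a)T(\xi)\sigma(b)$ for $\xi\in E$, $a,b\in\mathcal M$. Let $E^{\otimes n}\otimes_\sigma\mathcal H$ denote the interior tensor products, let $\widetilde T:E\otimes_\sigma\mathcal H\to\mathcal H$ be the bounded operator with $\widetilde T(\xi\otimes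 h)=T(\xi)h$, and for $n\ge 1$ put $\widetilde T_n=\widetilde T(I_E\otimes\widetilde T)\cdots(I_{E^{\otimes (n-1)}}\otimes\widetilde T):E^{\otimes n}\otimes_\sigma\mathcal H\to\mathcal H$. * $(\sigma,T)$ is *concave* if $\|\widetilde T_2u\|^2+\|u\|^2\le 2\|(I_E\otimes\widetilde T)u\|^2$ for all $u\in E^{\otimes 2}\otimes_\sigma\mathcal H$. * $(\sigma,T)$ is *analytic* if $\bigcap_{n\ge1}\widetilde T_n(E^{\otimes n}\otimes_\sigma\mathcal H)=\{0\}$. * A closed subspace $\mathcal K\subseteq\mathcal H$ is *$(\sigma,T)$-invariant* if $\sigma(a)\mathcal K\subseteq\mathcal K$ and $T(\xi)\mathcal K\subseteq\mathcal K$ for all $a\in\mathcal M$, $\xi\in E$. Write $E\otimes\mathcal K\subseteq E\otimes_\sigma\mathcal H$ for the closed linear span of the $\xi\otimes k$ with $\xi\in E$, $k\in\mathcal K$. * For a closed $\sigma(\mathcal M)$-invariant subspace $\mathcal W$, $\mathfrak L_n(\mathcal W)$ is the closed linear span of the vectors $T(\xi_1)\cdots T(\xi_n)h$ with $\xi_i\in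 E$, $h\in\mathcal W$ (so $\mathfrak L_0(\mathcal W)=\mathcal W$). Such a $\mathcal W$ is *wandering* if $\mathcal W\perp\mathfrak L_n(\mathcal W)$ for all $n\ge1$. **Theorem 2.4.** If $(\sigma,T)$ is analytic and concave, then for every $(\sigma,T)$-invariant closed subspace $\mathcal K$ of $\mathcal H$ the subspace $\mathcal W=\mathcal K\ominus\widetilde T(E\otimes\mathcal K)$, i.e. the set of vectors of $\mathcal K$ orthogonal to $\widetilde T(E\otimes\mathcal K)$, is wandering for $(\sigma,T)$ and $$\mathcal K=\bigvee_{n\ge0}\mathfrak L_n(\mathcal W).$$ In particular, $\ker\widetilde T^*$ is wandering and $\mathcal H=\bigvee_{n\ge0}\mathfrak L_n(\ker\widetilde T^*)$, where $\bigvee$ denotes the closed linear span. -/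

import Mathlib

namespace CStarCorr

open scoped TensorProduct InnerProductSpace
open MulOpposite

set_option linter.unusedSectionVars false

universe w u v

section Abstract

variable {A : Type*} [NonUnitalCStarAlgebra A] [PartialOrder A] [StarOrderedRing A]

theorem exists_factor {G : A} (hG : 0 ≤ G) : ∃ B : A, G = star B * B :=
  CStarAlgebra.nonneg_iff_eq_star_mul_self.mp hG

theorem exists_negPart {G : A} (hsa : IsSelfAdjoint G) :
    ∃ N : A, star N = N ∧ 0 ≤ N * N * N ∧ N * G * N = -(N * N * N) ∧ (N = 0 → 0 ≤ G) := by
  have hN : 0 ≤ G⁻ := CFC.negPart_nonneg G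
  have hNs : star G⁻ = G⁻ := (IsSelfAdjoint.of_nonneg hN).star_eq
  refine ⟨G⁻, hNs, ?_, ?_, (CFC.negPart_eq_zero_iff G hsa).mp⟩
  · have := star_left_conjugate_nonneg hN G⁻
    rwa [hNs] at this
  · have : G = G⁺ - G⁻ := (CFC.posPart_sub_negPart G hsa).symm
    conv_lhs => enter [1, 2]; rw [this]
    rw [mul_sub, CFC.negPart_mul_posPart, zero_sub, neg_mul]

end Abstract

section HilbertModule

variable {M : Type w} [NonUnitalCStarAlgebra M] [PartialOrder M] [StarOrderedRing M]
  {E : Type u} [NormedAddCommGroup E] [NormedSpace ℂ E] [SMul Mᵐᵒᵖ E] [CStarModule Mᵐᵒᵖ E]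

variable (M) in
/-- The `M`-valued inner product of a (right) Hilbert `M`-module `E`, linear in the second variable.
Mathlib's `CStarModule A E` has `⟪x, a • y⟫ = a * ⟪x, y⟫`, so that a right Hilbert module over `M`
(with right action `ξ · a = op a • ξ`) is exactly a `CStarModule Mᵐᵒᵖ E`; with `ip` read in `M`
one has `ip ξ (ζ · a) = ip ξ ζ * a` and `ip (ξ · a) ζ = star a * ip ξ ζ`. -/
def ip (ξ ζ : E) : M := unop (inner Mᵐᵒᵖ ξ ζ)

theorem ip_add_right (ξ ζ η : E) : ip M ξ (ζ + η) = ip M ξ ζ + ip M ξ η := by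
  simp [ip]

theorem ip_smul_right (c : ℂ) (ξ ζ : E) : ip M ξ (c • ζ) = c • ip M ξ ζ := by
  simp [ip]

theorem ip_op_smul_right (a : M) (ξ ζ : E) : ip M ξ (op a • ζ) = ip M ξ ζ * a := by
  simp [ip]

theorem star_ip (ξ ζ : E) : star (ip M ξ ζ) = ip M ζ ξ := by
  rw [ip, ip, ← unop_star, CStarModule.star_inner]

theorem ip_add_left (ξ ζ η : E) : ip M (ξ + ζ) η = ip M ξ η + ip M ζ η := by
  rw [← star_ip, ip_add_right, star_add, star_ip, star_ip]

theorem ip_smul_left (c : ℂ) (ξ ζ : E) : ip M (c • ξ) ζ = star c • ip M ξ ζ := by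
  rw [← star_ip, ip_smul_right, star_smul, star_ip]

theorem ip_op_smul_left (a : M) (ξ ζ : E) : ip M (op a • ξ) ζ = star a * ip M ξ ζ := by
  rw [← star_ip, ip_op_smul_right, star_mul, star_ip]

theorem ip_sum_right {ι : Type*} (s : Finset ι) (ξ : E) (ζ : ι → E) :
    ip M ξ (∑ i ∈ s, ζ i) = ∑ i ∈ s, ip M ξ (ζ i) := by
  simp [ip]

theorem ip_sum_left {ι : Type*} (s : Finset ι) (ξ : E) (ζ : ι → E) :
    ip M (∑ i ∈ s, ζ i) ξ = ∑ i ∈ s, ip M (ζ i) ξ := by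
  simp [ip]

theorem ip_sub_right (ξ ζ η : E) : ip M ξ (ζ - η) = ip M ξ ζ - ip M ξ η := by
  simp [ip]

theorem ip_sub_left (ξ ζ η : E) : ip M (ξ - ζ) η = ip M ξ η - ip M ζ η := by
  simp [ip]

theorem ip_self_nonneg (ξ : E) : 0 ≤ ip M ξ ξ :=
  CStarModule.inner_self_nonneg (A := Mᵐᵒᵖ) (x := ξ)

variable (M) in
theorem norm_sq_eq_ip (ξ : E) : ‖ξ‖ ^ 2 = ‖ip M ξ ξ‖ :=
  CStarModule.norm_sq_eq Mᵐᵒᵖ (x := ξ)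

theorem ip_ext {ξ ζ : E} (h : ∀ η : E, ip M η ξ = ip M η ζ) : ξ = ζ := by
  rw [← sub_eq_zero, ← CStarModule.inner_self (A := Mᵐᵒᵖ)]
  apply unop_injective
  change ip M (ξ - ζ) (ξ - ζ) = 0
  rw [ip_sub_right, h, sub_self]

variable (M) in
/-- The Gram matrix `(⟨ξ i, ξ j⟩)` in `M_n(M)`. -/
def gram {n : ℕ} (ξ : Fin n → E) : CStarMatrix (Fin n) (Fin n) M :=
  CStarMatrix.ofMatrix fun i j => ip M (ξ i) (ξ j)

theorem gram_apply {n : ℕ} (ξ : Fin n → E) (i j : Fin n) :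
    gram M ξ i j = ip M (ξ i) (ξ j) := rfl

/-- The row `ξ A`. -/
def rowMul {n : ℕ} (ξ : Fin n → E) (A : CStarMatrix (Fin n) (Fin n) M) : Fin n → E :=
  fun i => ∑ k, op (A k i) • ξ k

theorem ip_rowMul_right {n : ℕ} (ξ : Fin n → E) (A : CStarMatrix (Fin n) (Fin n) M) (η : E) (i) :
    ip M η (rowMul ξ A i) = ∑ k, ip M η (ξ k) * A k i := by
  simp [rowMul, ip_sum_right, ip_op_smul_right]

theorem ip_rowMul_left {n : ℕ} (ξ : Fin n → E) (A : CStarMatrix (Fin n) (Fin n) M) (η : E) (i) :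
    ip M (rowMul ξ A i) η = ∑ k, star (A k i) * ip M (ξ k) η := by
  simp [rowMul, ip_sum_left, ip_op_smul_left]

theorem gram_rowMul {n : ℕ} (ξ : Fin n → E) (A : CStarMatrix (Fin n) (Fin n) M) :
    gram M (rowMul ξ A) = star A * gram M ξ * A := by
  ext i j
  simp only [gram_apply, ip_rowMul_right, ip_rowMul_left, CStarMatrix.mul_apply,
    CStarMatrix.star_apply]

theorem isSelfAdjoint_gram {n : ℕ} (ξ : Fin n → E) : IsSelfAdjoint (gram M ξ) := by
  ext i j
  simp [CStarMatrix.star_apply, gram_apply, star_ip]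

theorem eq_zero_of_diag {n : ℕ} (A : CStarMatrix (Fin n) (Fin n) M) (hA : 0 ≤ A)
    (hd : ∀ i, A i i ≤ 0) : A = 0 := by
  obtain ⟨B, rfl⟩ := exists_factor hA
  have key : ∀ i k, B k i = 0 := by
    intro i k
    have h1 : (star B * B) i i = ∑ k, star (B k i) * B k i := by
      simp [CStarMatrix.mul_apply, CStarMatrix.star_apply]
    have h2 : ∑ k, star (B k i) * B k i = 0 :=
      le_antisymm (h1 ▸ hd i) (Finset.sum_nonneg fun k _ => star_mul_self_nonneg _)
    have h3 := (Finset.sum_eq_zero_iff_of_nonneg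
      (fun k _ => star_mul_self_nonneg (B k i))).mp h2 k (Finset.mem_univ _)
    exact (CStarRing.star_mul_self_eq_zero_iff _).mp h3
  have : B = 0 := by ext k i; exact key i k
  simp [this]

theorem gram_nonneg {n : ℕ} (ξ : Fin n → E) : 0 ≤ gram M ξ := by
  obtain ⟨N, hNs, hc, hNG, hz⟩ := exists_negPart (isSelfAdjoint_gram (M := M) ξ)
  apply hz
  have h1 : gram M (rowMul ξ N) = -(N * N * N) := by
    rw [gram_rowMul, hNs, hNG]
  have h0 : N * N * N = 0 := by
    apply eq_zero_of_diag _ hc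
    intro i
    have h2 : 0 ≤ gram M (rowMul ξ N) i i := ip_self_nonneg _
    rw [h1] at h2
    simpa using h2
  have h4 : (N * N) * star (N * N) = 0 := by
    rw [star_mul, hNs, ← mul_assoc, h0, zero_mul]
  have h5 : N * star N = 0 := by
    rw [hNs]; exact (CStarRing.mul_star_self_eq_zero_iff _).mp h4
  exact (CStarRing.mul_star_self_eq_zero_iff _).mp h5

theorem exists_gram_factor {n : ℕ} (ξ : Fin n → E) :
    ∃ B : Fin n → Fin n → M,
      ∀ i j, ip M (ξ i) (ξ j) = ∑ k, star (B k i) * B k j := by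
  obtain ⟨B, hB⟩ := exists_factor (gram_nonneg (M := M) ξ)
  refine ⟨fun i j => B i j, fun i j => ?_⟩
  rw [← gram_apply, hB]
  simp [CStarMatrix.mul_apply, CStarMatrix.star_apply]

end HilbertModule

section InteriorTensor

variable {M : Type w} [NonUnitalCStarAlgebra M] [PartialOrder M] [StarOrderedRing M]
  {E : Type u} [NormedAddCommGroup E] [NormedSpace ℂ E] [SMul Mᵐᵒᵖ E] [CStarModule Mᵐᵒᵖ E]
  {X : Type v} [NormedAddCommGroup X] [InnerProductSpace ℂ X] [CompleteSpace X]

variable (E) in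
/-- The algebraic tensor product `E ⊗ X`, to be equipped with the semi-inner product
`⟪ξ ⊗ h, ζ ⊗ k⟫ = ⟪h, π(⟨ξ, ζ⟩) k⟫`. -/
@[nolint unusedArguments]
def PreTensor (_π : M →⋆ₙₐ[ℂ] (X →L[ℂ] X)) : Type (max u v) := E ⊗[ℂ] X

variable (π : M →⋆ₙₐ[ℂ] (X →L[ℂ] X))

instance : AddCommGroup (PreTensor E π) := inferInstanceAs (AddCommGroup (E ⊗[ℂ] X))

instance : Module ℂ (PreTensor E π) := inferInstanceAs (Module ℂ (E ⊗[ℂ] X))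

/-- The elementary tensor `ξ ⊗ h` in the algebraic tensor product. -/
def preTmul (ξ : E) (h : X) : PreTensor E π := ξ ⊗ₜ[ℂ] h

/-- The linear functional `ζ ⊗ k ↦ ⟪h, π(⟨ξ, ζ⟩) k⟫`. -/
noncomputable def formAux (ξ : E) (h : X) : PreTensor E π →ₗ[ℂ] ℂ :=
  TensorProduct.lift (LinearMap.mk₂ ℂ (fun (ζ : E) (k : X) => ⟪h, π (ip M ξ ζ) k⟫_ℂ)
    (by intro a b k; simp [ip_add_right])
    (by intro c a k; simp [ip_smul_right])
    (by intro a k l; simp)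
    (by intro c a k; simp))

theorem formAux_tmul (ξ ζ : E) (h k : X) :
    formAux π ξ h (preTmul π ζ k) = ⟪h, π (ip M ξ ζ) k⟫_ℂ := rfl

theorem preTensor_ext {P : Type*} [AddCommGroup P] [Module ℂ P] {f g : PreTensor E π →ₗ[ℂ] P}
    (h : ∀ ξ x, f (preTmul π ξ x) = g (preTmul π ξ x)) : f = g :=
  TensorProduct.ext' h

/-- The sesquilinear form with `⟪ξ ⊗ h, ζ ⊗ k⟫ = ⟪h, π(⟨ξ, ζ⟩) k⟫`. -/
noncomputable def form : PreTensor E π →ₗ⋆[ℂ] PreTensor E π →ₗ[ℂ] ℂ :=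
  TensorProduct.lift (LinearMap.mk₂'ₛₗ (starRingEnd ℂ) (starRingEnd ℂ) (formAux π)
    (by
      intro a b k; apply preTensor_ext; intro ξ x
      simp [formAux_tmul, ip_add_left])
    (by
      intro c a k; apply preTensor_ext; intro ξ x
      simp [formAux_tmul, ip_smul_left, mul_comm])
    (by
      intro a k l; apply preTensor_ext; intro ξ x
      simp [formAux_tmul])
    (by
      intro c a k; apply preTensor_ext; intro ξ x
      simp [formAux_tmul, mul_comm]))

theorem form_tmul (ξ ζ : E) (h k : X) :
    form π (preTmul π ξ h) (preTmul π ζ k) = ⟪h, π (ip M ξ ζ) k⟫_ℂ := rfl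

theorem preTensor_exists_sum (u : PreTensor E π) :
    ∃ (n : ℕ) (ξ : Fin n → E) (h : Fin n → X), u = ∑ i, preTmul π (ξ i) (h i) := by
  obtain ⟨n, ξ, h, hu⟩ := TensorProduct.exists_sum_tmul_eq (R := ℂ) (M := E) (N := X) u
  exact ⟨n, ξ, h, hu⟩

@[elab_as_elim]
theorem preTensor_induction {p : PreTensor E π → Prop} (u : PreTensor E π)
    (tmul : ∀ ξ h, p (preTmul π ξ h)) (add : ∀ x y, p x → p y → p (x + y)) : p u :=
  TensorProduct.induction_on u
    (by simpa [preTmul] using! tmul 0 0) tmul add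

theorem form_sum {n m : ℕ} (ξ : Fin n → E) (h : Fin n → X) (ζ : Fin m → E) (k : Fin m → X) :
    form π (∑ i, preTmul π (ξ i) (h i)) (∑ j, preTmul π (ζ j) (k j)) =
      ∑ i, ∑ j, ⟪h i, π (ip M (ξ i) (ζ j)) (k j)⟫_ℂ := by
  simp only [map_sum, LinearMap.sum_apply, form_tmul]
  rw [Finset.sum_comm]

/-- If `⟨ξ i, ξ j⟩ = ∑ k, star (B k i) * B k j`, then the form is a sum of squares. -/
theorem form_self_eq {n : ℕ} (ξ : Fin n → E) (h : Fin n → X)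
    (B : Fin n → Fin n → M)
    (hB : ∀ i j, ip M (ξ i) (ξ j) = ∑ k, star (B k i) * B k j) :
    form π (∑ i, preTmul π (ξ i) (h i)) (∑ j, preTmul π (ξ j) (h j)) =
      ((∑ k, ‖∑ j, π (B k j) (h j)‖ ^ 2 : ℝ) : ℂ) := by
  rw [form_sum]
  simp only [hB, map_sum, map_mul, map_star, _root_.sum_apply, inner_sum,
    mul_apply_eq_comp, ContinuousLinearMap.star_eq_adjoint,
    ContinuousLinearMap.adjoint_inner_right]
  push_cast
  have : ∀ k, (‖∑ j, π (B k j) (h j)‖ : ℂ) ^ 2 =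
      ∑ i, ∑ j, ⟪π (B k i) (h i), π (B k j) (h j)⟫_ℂ := by
    intro k
    have := inner_self_eq_norm_sq_to_K (𝕜 := ℂ) (∑ j, π (B k j) (h j))
    simp only [sum_inner, inner_sum] at this
    rw [Finset.sum_comm]
    exact this.symm
  simp only [this]
  rw [Finset.sum_comm]
  conv_lhs => enter [2, i]; rw [Finset.sum_comm]
  rw [Finset.sum_comm]
  refine Finset.sum_congr rfl fun k _ => ?_
  rw [Finset.sum_comm]

theorem form_star (u v : PreTensor E π) : star (form π v u) = form π u v := by
  induction u using preTensor_induction with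
  | tmul ξ h =>
    induction v using preTensor_induction with
    | tmul ζ k =>
      rw [form_tmul, form_tmul, ← star_ip, map_star, ContinuousLinearMap.star_eq_adjoint,
        ContinuousLinearMap.adjoint_inner_right]
      exact inner_conj_symm _ _
    | add x y hx hy => simp [map_add, star_add, ← hx, ← hy]
  | add x y hx hy => simp [map_add, star_add, ← hx, ← hy]

theorem form_self_nonneg (u : PreTensor E π) : 0 ≤ (form π u u).re := by
  obtain ⟨n, ξ, h, rfl⟩ := preTensor_exists_sum π u
  obtain ⟨B, hB⟩ := exists_gram_factor (M := M) ξ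
  rw [form_self_eq π ξ h B hB, Complex.ofReal_re]
  positivity

/-- The semi-inner product on the algebraic tensor product. -/
noncomputable abbrev preTensorCore : PreInnerProductSpace.Core ℂ (PreTensor E π) where
  inner u v := form π u v
  conj_inner_symm u v := form_star π u v
  re_inner_nonneg u := form_self_nonneg π u
  add_left u v x := by simp
  smul_left u v c := by simp

noncomputable instance : SeminormedAddCommGroup (PreTensor E π) :=
  InnerProductSpace.Core.toSeminormedAddCommGroup (c := preTensorCore π)

noncomputable instance : InnerProductSpace ℂ (PreTensor E π) :=
  InnerProductSpace.ofCore (preTensorCore π)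

theorem pre_inner_def (u v : PreTensor E π) : ⟪u, v⟫_ℂ = form π u v := rfl

theorem pre_norm_sq (u : PreTensor E π) : ((‖u‖ ^ 2 : ℝ) : ℂ) = form π u u := by
  rw [← pre_inner_def, inner_self_eq_norm_sq_to_K]; simp

theorem pre_norm_sq_re (u : PreTensor E π) : ‖u‖ ^ 2 = (form π u u).re := by
  rw [← pre_norm_sq, Complex.ofReal_re]

theorem pre_norm_sq_sum {n : ℕ} (ξ : Fin n → E) (h : Fin n → X)
    (B : Fin n → Fin n → M)
    (hB : ∀ i j, ip M (ξ i) (ξ j) = ∑ k, star (B k i) * B k j) :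
    ‖∑ i, preTmul π (ξ i) (h i)‖ ^ 2 = ∑ k, ‖∑ j, π (B k j) (h j)‖ ^ 2 := by
  rw [pre_norm_sq_re, form_self_eq π ξ h B hB, Complex.ofReal_re]

variable (E) in
/-- The interior tensor product `E ⊗_π X` of the Hilbert module `E` with the Hilbert space `X`
carrying the representation `π`: the (separated) completion of the algebraic tensor product for
`⟪ξ ⊗ h, ζ ⊗ k⟫ = ⟪h, π(⟨ξ, ζ⟩) k⟫`. The balancing relations `ξ a ⊗ h = ξ ⊗ π(a) h` hold because
the differences are null vectors. -/
abbrev HTensor : Type (max u v) := UniformSpace.Completion (PreTensor E π)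

/-- The elementary tensor `ξ ⊗ h` in `E ⊗_π X`. -/
noncomputable def tmul (ξ : E) (h : X) : HTensor E π := (preTmul π ξ h : PreTensor E π)

theorem inner_tmul_tmul (ξ ζ : E) (h k : X) :
    ⟪tmul π ξ h, tmul π ζ k⟫_ℂ = ⟪h, π (ip M ξ ζ) k⟫_ℂ := by
  rw [tmul, tmul, UniformSpace.Completion.inner_coe, pre_inner_def, form_tmul]

section Amplification

variable {Y : Type*} [NormedAddCommGroup Y] [InnerProductSpace ℂ Y] [CompleteSpace Y]

/-- `ξ ⊗ h ↦ ξ ⊗ S h` on the algebraic tensor product. -/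
noncomputable def preAmp (ρ : M →⋆ₙₐ[ℂ] (Y →L[ℂ] Y)) (S : X →L[ℂ] Y) :
    PreTensor E π →ₗ[ℂ] PreTensor E ρ :=
  TensorProduct.map LinearMap.id (S : X →ₗ[ℂ] Y)

theorem preAmp_tmul (ρ : M →⋆ₙₐ[ℂ] (Y →L[ℂ] Y)) (S : X →L[ℂ] Y) (ξ : E) (h : X) :
    preAmp π ρ S (preTmul π ξ h) = preTmul ρ ξ (S h) := rfl

theorem preAmp_bound (ρ : M →⋆ₙₐ[ℂ] (Y →L[ℂ] Y)) (S : X →L[ℂ] Y)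
    (hS : ∀ a x, S (π a x) = ρ a (S x)) (u : PreTensor E π) :
    ‖preAmp π ρ S u‖ ≤ ‖S‖ * ‖u‖ := by
  obtain ⟨n, ξ, h, rfl⟩ := preTensor_exists_sum π u
  obtain ⟨B, hB⟩ := exists_gram_factor (M := M) ξ
  rw [← sq_le_sq₀ (by positivity) (by positivity), mul_pow, map_sum]
  simp only [preAmp_tmul]
  rw [pre_norm_sq_sum ρ ξ _ B hB, pre_norm_sq_sum π ξ h B hB, Finset.mul_sum]
  refine Finset.sum_le_sum fun k _ => ?_
  simp only [← hS]
  rw [← map_sum, ← mul_pow]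
  gcongr
  exact S.le_opNorm _

/-- For a bounded operator `S : X → Y` intertwining `π` and `ρ`, the bounded operator
`I_E ⊗ S : E ⊗_π X → E ⊗_ρ Y`, `ξ ⊗ h ↦ ξ ⊗ S h`. -/
noncomputable def amp (ρ : M →⋆ₙₐ[ℂ] (Y →L[ℂ] Y)) (S : X →L[ℂ] Y)
    (hS : ∀ a x, S (π a x) = ρ a (S x)) : HTensor E π →L[ℂ] HTensor E ρ :=
  ((preAmp π ρ S).mkContinuous ‖S‖ (preAmp_bound π ρ S hS)).completion

theorem amp_tmul (ρ : M →⋆ₙₐ[ℂ] (Y →L[ℂ] Y)) (S : X →L[ℂ] Y)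
    (hS : ∀ a x, S (π a x) = ρ a (S x)) (ξ : E) (h : X) :
    amp π ρ S hS (tmul π ξ h) = tmul ρ ξ (S h) := by
  simp [amp, tmul, preAmp_tmul]

end Amplification

end InteriorTensor

section Abstract2

variable {A : Type*} [NonUnitalCStarAlgebra A] [PartialOrder A] [StarOrderedRing A]

/-- A self-adjoint `m` with `(‖a‖ + m)² = ‖a‖² - a* a` (in the unitization). -/
theorem exists_defect (a : A) :
    ∃ m : A, star m = m ∧ (2 * ‖a‖ : ℝ) • m + m * m = -(star a * a) := by
  set b : A := star a * a with hb
  have hb0 : 0 ≤ b := star_mul_self_nonneg a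
  have hbs : IsSelfAdjoint b := .of_nonneg hb0
  have hbn : ‖b‖ = ‖a‖ ^ 2 := by rw [hb, CStarRing.norm_star_mul_self, sq]
  set g : ℝ → ℝ := fun t => √(‖a‖ ^ 2 - t) - ‖a‖ with hg
  have hgc : Continuous g := by fun_prop
  have hg0 : g 0 = 0 := by simp [hg]
  refine ⟨cfcₙ g b, (cfcₙ_predicate g b : IsSelfAdjoint _).star_eq, ?_⟩
  rw [← cfcₙ_smul (2 * ‖a‖ : ℝ) g b hgc.continuousOn hg0,
    ← cfcₙ_mul g g b hgc.continuousOn hg0 hgc.continuousOn hg0,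
    ← cfcₙ_add (fun t => (2 * ‖a‖ : ℝ) • g t) (fun t => g t * g t) b
      (by fun_prop) (by simp [hg0]) (by fun_prop) (by simp [hg0])]
  conv_rhs => rw [← cfcₙ_id' ℝ b, ← cfcₙ_neg]
  apply cfcₙ_congr
  intro t ht
  have h1 : t ≤ ‖a‖ ^ 2 := by
    rw [← hbn]
    exact (le_abs_self t).trans (NonUnitalIsometricContinuousFunctionalCalculus.norm_quasispectrum_le b ht)
  have h2 := Real.mul_self_sqrt (sub_nonneg.mpr h1)
  simp only [hg, smul_eq_mul]
  linear_combination h2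

/-- Approximate factorization data for a positive element. -/
theorem exists_approx {G : A} (hG : 0 ≤ G) {ε : ℝ} (hε : 0 < ε) :
    ∃ s a : A, star s = s ∧ s * s = G ∧ star a = a ∧ ‖a * G * a‖ ≤ 1 ∧
      ‖G - s * a * G - G * a * s + s * a * G * a * s‖ ≤ ε := by
  set s : A := CFC.sqrt G with hs
  have hs0 : 0 ≤ s := CFC.sqrt_nonneg G
  have hss : IsSelfAdjoint s := .of_nonneg hs0
  have hsG : s * s = G := CFC.sqrt_mul_sqrt_self G hG
  set f : ℝ → ℝ := fun t => t / (t ^ 2 + ε) with hf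
  have hpos : ∀ t : ℝ, 0 < t ^ 2 + ε := fun t => by positivity
  have hfc : Continuous f := by
    refine Continuous.div (by fun_prop) (by fun_prop) fun t => (hpos t).ne'
  have hf0 : f 0 = 0 := by simp [hf]
  have hid : cfcₙ (fun t : ℝ => t) s = s := cfcₙ_id' ℝ s
  have hmul : ∀ p q : ℝ → ℝ, Continuous p → p 0 = 0 → Continuous q → q 0 = 0 →
      cfcₙ p s * cfcₙ q s = cfcₙ (fun t => p t * q t) s := fun p q hp hp0 hq hq0 =>
    (cfcₙ_mul p q s hp.continuousOn hp0 hq.continuousOn hq0).symm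
  have hadd : ∀ p q : ℝ → ℝ, Continuous p → p 0 = 0 → Continuous q → q 0 = 0 →
      cfcₙ p s + cfcₙ q s = cfcₙ (fun t => p t + q t) s := fun p q hp hp0 hq hq0 =>
    (cfcₙ_add p q s hp.continuousOn hp0 hq.continuousOn hq0).symm
  have hsub : ∀ p q : ℝ → ℝ, Continuous p → p 0 = 0 → Continuous q → q 0 = 0 →
      cfcₙ p s - cfcₙ q s = cfcₙ (fun t => p t - q t) s := fun p q hp hp0 hq hq0 =>
    (cfcₙ_sub p q s hp.continuousOn hp0 hq.continuousOn hq0).symm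
  refine ⟨s, cfcₙ f s, hss.star_eq, hsG, (cfcₙ_predicate f s : IsSelfAdjoint _).star_eq, ?_, ?_⟩
  · have : cfcₙ f s * G * cfcₙ f s = cfcₙ (fun t => f t * (t * t) * f t) s := by
      rw [← hsG]
      nth_rw 2 [← hid]
      nth_rw 3 [← hid]
      rw [hmul _ _ continuous_id' rfl continuous_id' rfl,
        hmul _ _ hfc hf0 (by fun_prop) (by simp),
        hmul _ _ (by fun_prop) (by simp) hfc hf0]
    rw [this]
    refine norm_cfcₙ_le fun t _ => ?_
    have h1 : f t * (t * t) * f t = (t ^ 2 / (t ^ 2 + ε)) ^ 2 := by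
      simp only [hf]; ring
    rw [h1, Real.norm_of_nonneg (by positivity)]
    refine pow_le_one₀ (by positivity) ?_
    rw [div_le_one (hpos t)]
    linarith
  · have : G - s * cfcₙ f s * G - G * cfcₙ f s * s + s * cfcₙ f s * G * cfcₙ f s * s =
        cfcₙ (fun t => t * t - t * f t * (t * t) - t * t * f t * t +
          t * f t * (t * t) * f t * t) s := by
      have hG' : G = cfcₙ (fun t : ℝ => t * t) s := by
        rw [← hmul _ _ continuous_id' rfl continuous_id' rfl, hid, hsG]
      have e1 : s * cfcₙ f s = cfcₙ (fun t => t * f t) s := by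
        conv_lhs => enter [1]; rw [← hid]
        exact hmul _ _ continuous_id' rfl hfc hf0
      have e2 : ∀ p : ℝ → ℝ, Continuous p → p 0 = 0 →
          cfcₙ p s * s = cfcₙ (fun t => p t * t) s := fun p hp hp0 => by
        conv_lhs => enter [2]; rw [← hid]
        exact hmul _ _ hp hp0 continuous_id' rfl
      rw [e1, hG', hmul _ _ (by fun_prop) (by simp) (by fun_prop) (by simp),
        hmul _ f (by fun_prop) (by simp) (by fun_prop) (by simp [hf0]),
        hmul _ f (by fun_prop) (by simp) (by fun_prop) (by simp [hf0]),
        e2 _ (by fun_prop) (by simp), e2 _ (by fun_prop) (by simp),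
        hsub _ _ (by fun_prop) (by simp) (by fun_prop) (by simp),
        hsub _ _ (by fun_prop) (by simp) (by fun_prop) (by simp),
        hadd _ _ (by fun_prop) (by simp) (by fun_prop) (by simp)]
    rw [this]
    refine norm_cfcₙ_le fun t _ => ?_
    have h1 : t * t - t * f t * (t * t) - t * t * f t * t + t * f t * (t * t) * f t * t =
        (t * ε / (t ^ 2 + ε)) ^ 2 := by
      simp only [hf]
      field_simp
      ring
    rw [h1, Real.norm_of_nonneg (by positivity), div_pow, div_le_iff₀ (by positivity)]
    nlinarith [mul_nonneg hε.le (sq_nonneg (t ^ 2)), sq_nonneg (t ^ 2 + ε), pow_pos hε 3,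
      mul_nonneg (sq_nonneg t) (sq_nonneg ε)]

end Abstract2

section LeftAction

variable (M : Type w) [NonUnitalCStarAlgebra M] [PartialOrder M] [StarOrderedRing M]
  (E : Type u) [NormedAddCommGroup E] [NormedSpace ℂ E] [SMul Mᵐᵒᵖ E] [CStarModule Mᵐᵒᵖ E]

/-- The structure of a `C⋆`-correspondence over `M` on a Hilbert `M`-module `E`: a left action by
a non-zero, essential `⋆`-homomorphism of `M` into the adjointable operators on `E`. (The identity
`ip_left` says that `left a` is adjointable with adjoint `left (star a)`.) -/
class Correspondence where
  left : M →ₙₐ[ℂ] (E →L[ℂ] E)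
  ip_left : ∀ (a : M) (ξ ζ : E), ip M (left a ξ) ζ = ip M ξ (left (star a) ζ)
  left_ne_zero : left ≠ 0
  essential : (Submodule.span ℂ {η : E | ∃ a ξ, left a ξ = η}).topologicalClosure = ⊤

variable {M E} [Correspondence M E]

/-- The left action `ξ ↦ φ(a) ξ`. -/
def left (a : M) : E →L[ℂ] E := Correspondence.left a

variable (M E) in
/-- The left action stays essential when restricted to the closed ideal of `M` generated by the
inner products of `E`: the closed linear span of `φ(⟨ξ, η⟩) ζ` with `ξ, η, ζ ∈ E` is `E`. Every full
correspondence has this property, since `φ` itself is essential. -/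
def InnerEssential : Prop :=
  (Submodule.span ℂ {x : E | ∃ ξ η ζ : E, left (ip M ξ η) ζ = x}).topologicalClosure = ⊤

theorem ip_left (a : M) (ξ ζ : E) : ip M (left a ξ) ζ = ip M ξ (left (star a) ζ) :=
  Correspondence.ip_left a ξ ζ

variable {X : Type v} [NormedAddCommGroup X] [InnerProductSpace ℂ X] [CompleteSpace X]
  (π : M →⋆ₙₐ[ℂ] (X →L[ℂ] X))

/-- `φ(a) ⊗ I` on the algebraic tensor product. -/
noncomputable def preLeft : M →ₙₐ[ℂ] Module.End ℂ (PreTensor E π) where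
  toFun a := TensorProduct.map ((left a : E →L[ℂ] E) : E →ₗ[ℂ] E) LinearMap.id
  map_smul' c a := by
    apply preTensor_ext; intro ξ x
    change (left (c • a) ξ) ⊗ₜ[ℂ] x = c • (left a ξ ⊗ₜ[ℂ] x)
    simp [left, TensorProduct.smul_tmul']
  map_zero' := by
    apply preTensor_ext; intro ξ x
    change (left (0 : M) ξ) ⊗ₜ[ℂ] x = (0 : E ⊗[ℂ] X)
    simp [left]
  map_add' a b := by
    apply preTensor_ext; intro ξ x
    change (left (a + b) ξ) ⊗ₜ[ℂ] x = left a ξ ⊗ₜ[ℂ] x + left b ξ ⊗ₜ[ℂ] x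
    simp [left, TensorProduct.add_tmul]
  map_mul' a b := by
    apply preTensor_ext; intro ξ x
    change (left (a * b) ξ) ⊗ₜ[ℂ] x = left a (left b ξ) ⊗ₜ[ℂ] x
    simp [left]

theorem preLeft_tmul (a : M) (ξ : E) (h : X) :
    preLeft π a (preTmul π ξ h) = preTmul π (left a ξ) h := rfl

theorem form_preLeft (a : M) (u v : PreTensor E π) :
    form π (preLeft π a u) v = form π u (preLeft π (star a) v) := by
  induction u using preTensor_induction with
  | tmul ξ h =>
    induction v using preTensor_induction with
    | tmul ζ k => rw [preLeft_tmul, preLeft_tmul, form_tmul, form_tmul, ip_left]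
    | add x y hx hy => simp [map_add, hx, hy]
  | add x y hx hy => simp [map_add, hx, hy]

theorem preLeft_bound (a : M) (u : PreTensor E π) : ‖preLeft π a u‖ ≤ ‖a‖ * ‖u‖ := by
  obtain ⟨m, hm, hma⟩ := exists_defect a
  have hma' : ((2 * ‖a‖ : ℝ) : ℂ) • m + m * m = -(star a * a) := by
    rw [← hma]; norm_cast
  rw [← sq_le_sq₀ (by positivity) (by positivity), mul_pow, pre_norm_sq_re, pre_norm_sq_re]
  have h0 := form_self_nonneg π ((‖a‖ : ℂ) • u + preLeft π m u)
  have h1 : form π (preLeft π a u) (preLeft π a u) = form π u (preLeft π (star a * a) u) := by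
    rw [form_preLeft, map_mul]; rfl
  have h2 : form π ((‖a‖ : ℂ) • u + preLeft π m u) ((‖a‖ : ℂ) • u + preLeft π m u) =
      (‖a‖ : ℂ) ^ 2 * form π u u +
        form π u (preLeft π (((2 * ‖a‖ : ℝ) : ℂ) • m + m * m) u) := by
    simp only [map_add, LinearMap.add_apply, map_smulₛₗ, form_preLeft, hm, LinearMap.smul_apply,
      map_mul, Module.End.mul_apply, Complex.conj_ofReal, smul_eq_mul, RingHom.id_apply]
    push_cast
    ring
  rw [h2, hma', map_neg, LinearMap.neg_apply, map_neg, ← h1] at h0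
  have h3 : ((‖a‖ : ℂ) ^ 2 * form π u u).re = ‖a‖ ^ 2 * (form π u u).re := by
    rw [← Complex.ofReal_pow, Complex.re_ofReal_mul]
  rw [Complex.add_re, Complex.neg_re, h3] at h0
  linarith

theorem htensor_ext {Y : Type*} [NormedAddCommGroup Y] [NormedSpace ℂ Y]
    {S S' : HTensor E π →L[ℂ] Y} (h : ∀ (ξ : E) x, S (tmul π ξ x) = S' (tmul π ξ x)) :
    S = S' := by
  ext x
  induction x using UniformSpace.Completion.induction_on with
  | hp => exact isClosed_eq S.continuous S'.continuous
  | ih x =>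
    induction x using preTensor_induction with
    | tmul ξ x => exact h ξ x
    | add x y hx hy => rw [UniformSpace.Completion.coe_add, map_add, map_add, hx, hy]

/-- `φ(a) ⊗ I` on `E ⊗_π X`. -/
noncomputable def leftH (a : M) : HTensor E π →L[ℂ] HTensor E π :=
  ((preLeft π a).mkContinuous ‖a‖ (preLeft_bound π a)).completion

theorem leftH_coe (a : M) (u : PreTensor E π) :
    leftH π a (u : HTensor E π) = (preLeft π a u : PreTensor E π) :=
  ContinuousLinearMap.completion_apply_coe _ _

theorem leftH_tmul (a : M) (ξ : E) (h : X) :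
    leftH π a (tmul π ξ h) = tmul π (left a ξ) h :=
  leftH_coe π a _

theorem inner_leftH (a : M) (x y : HTensor E π) :
    ⟪leftH π (star a) x, y⟫_ℂ = ⟪x, leftH π a y⟫_ℂ := by
  induction x, y using UniformSpace.Completion.induction_on₂ with
  | hp =>
    refine isClosed_eq ?_ ?_
    · exact Continuous.inner ((leftH π (star a)).continuous.comp continuous_fst) continuous_snd
    · exact Continuous.inner continuous_fst ((leftH π a).continuous.comp continuous_snd)
  | ih x y =>
    rw [leftH_coe, leftH_coe, UniformSpace.Completion.inner_coe,
      UniformSpace.Completion.inner_coe, pre_inner_def, pre_inner_def, form_preLeft, star_star]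

/-- The representation `a ↦ φ(a) ⊗ I` of `M` on `E ⊗_π X`. -/
noncomputable def tensorRep : M →⋆ₙₐ[ℂ] (HTensor E π →L[ℂ] HTensor E π) where
  toFun a := leftH π a
  map_smul' c a := by
    apply htensor_ext; intro ξ x
    change leftH π (c • a) _ = c • leftH π a _
    simp only [tmul, leftH_coe, map_smul, LinearMap.smul_apply, UniformSpace.Completion.coe_smul]
  map_zero' := by
    apply htensor_ext; intro ξ x
    change leftH π 0 _ = 0
    simp only [tmul, leftH_coe, map_zero, LinearMap.zero_apply, UniformSpace.Completion.coe_zero]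
  map_add' a b := by
    apply htensor_ext; intro ξ x
    change leftH π (a + b) _ = leftH π a _ + leftH π b _
    simp only [tmul, leftH_coe, map_add, LinearMap.add_apply, UniformSpace.Completion.coe_add]
  map_mul' a b := by
    apply htensor_ext; intro ξ x
    change leftH π (a * b) _ = leftH π a (leftH π b _)
    simp only [tmul, leftH_coe, map_mul, Module.End.mul_apply]
  map_star' a := by
    rw [ContinuousLinearMap.star_eq_adjoint, ContinuousLinearMap.eq_adjoint_iff]
    exact inner_leftH π a

theorem tensorRep_tmul (a : M) (ξ : E) (h : X) :
    tensorRep π a (tmul π ξ h) = tmul π (left a ξ) h :=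
  leftH_tmul π a ξ h

theorem amp_tensorRep {Y : Type*} [NormedAddCommGroup Y] [InnerProductSpace ℂ Y] [CompleteSpace Y]
    (ρ : M →⋆ₙₐ[ℂ] (Y →L[ℂ] Y)) (S : X →L[ℂ] Y)
    (hS : ∀ a x, S (π a x) = ρ a (S x)) (a : M) (x : HTensor E π) :
    amp π ρ S hS (tensorRep π a x) = tensorRep ρ a (amp π ρ S hS x) := by
  have : amp π ρ S hS ∘L tensorRep π a = tensorRep ρ a ∘L amp π ρ S hS :=
    htensor_ext π fun (ξ : E) x => by simp [tensorRep_tmul, amp_tmul]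
  exact congr($this x)

end LeftAction

section Covariant

variable (M : Type w) [NonUnitalCStarAlgebra M] [PartialOrder M] [StarOrderedRing M]
  (E : Type u) [NormedAddCommGroup E] [NormedSpace ℂ E] [SMul Mᵐᵒᵖ E] [CStarModule Mᵐᵒᵖ E]
  (H : Type v) [NormedAddCommGroup H] [InnerProductSpace ℂ H] [CompleteSpace H]

variable {E} in
/-- The norm on `M_n(E)` for the operator space structure of a Hilbert module (as a corner of its
linking algebra): `‖(ξ i j)‖² = ‖(∑ k, ⟨ξ k i, ξ k j⟩)‖` in the `C⋆`-algebra `M_n(M)`. -/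
noncomputable def matNorm {n : ℕ} (ξ : Fin n → Fin n → E) : ℝ :=
  √‖(CStarMatrix.ofMatrix fun i j => ∑ k, ip M (ξ k i) (ξ k j) :
    CStarMatrix (Fin n) (Fin n) M)‖

variable {E H} in
/-- `T : E → B(H)` is completely bounded: the amplifications `M_n(E) → M_n(B(H)) = B(Hⁿ)` are
bounded uniformly in `n`. -/
def IsCompletelyBounded (T : E →ₗ[ℂ] (H →L[ℂ] H)) : Prop :=
  ∃ C : ℝ, ∀ (n : ℕ) (ξ : Fin n → Fin n → E) (h : Fin n → H),
    ∑ i, ‖∑ j, T (ξ i j) (h j)‖ ^ 2 ≤ (C * matNorm M ξ) ^ 2 * ∑ j, ‖h j‖ ^ 2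

/-- A completely bounded covariant representation `(σ, T)` of the `C⋆`-correspondence `E` on the
Hilbert space `H`: an essential representation `σ` of `M` and a completely bounded linear map `T`
with `T(a ξ b) = σ(a) T(ξ) σ(b)`. -/
structure CovRep [Correspondence M E] where
  σ : M →⋆ₙₐ[ℂ] (H →L[ℂ] H)
  T : E →ₗ[ℂ] (H →L[ℂ] H)
  nondegenerate : (Submodule.span ℂ {k : H | ∃ a h, σ a h = k}).topologicalClosure = ⊤
  covariant : ∀ (a : M) (ξ : E) (b : M), T (left a (op b • ξ)) = σ a * T ξ * σ b
  completelyBounded : IsCompletelyBounded M T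

variable {M E H}

theorem op_smul_op_smul (a b : M) (ξ : E) : op b • op a • ξ = op (a * b) • ξ :=
  ip_ext (M := M) fun η => by simp only [ip_op_smul_right, mul_assoc]

theorem left_op_smul [Correspondence M E] (a b : M) (ξ : E) :
    left a (op b • ξ) = op b • left a ξ :=
  ip_ext (M := M) fun η => by
    rw [ip_op_smul_right, ← star_star a, ← ip_left, ip_op_smul_right, ← ip_left]

namespace CovRep

variable [Correspondence M E] (R : CovRep M E H)

theorem eq_zero_of_mul_σ {X : H →L[ℂ] H} (h : ∀ b, X * R.σ b = 0) : X = 0 := by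
  have h1 : (Submodule.span ℂ {k : H | ∃ a h, R.σ a h = k}) ≤ X.ker := by
    rw [Submodule.span_le]
    rintro _ ⟨a, x, rfl⟩
    exact congr($(h a) x)
  have h2 := Submodule.topologicalClosure_minimal _ h1 X.isClosed_ker
  rw [R.nondegenerate] at h2
  ext x
  exact h2 (Submodule.mem_top (x := x))

theorem eq_zero_of_σ_mul {X : H →L[ℂ] H} (h : ∀ a, R.σ a * X = 0) : X = 0 := by
  rw [← star_eq_zero]
  refine R.eq_zero_of_mul_σ fun b => ?_
  rw [← star_star b, map_star, ← star_mul, h, star_zero]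

theorem T_left (a : M) (ξ : E) : R.T (left a ξ) = R.σ a * R.T ξ := by
  rw [← sub_eq_zero]
  refine R.eq_zero_of_σ_mul fun c => R.eq_zero_of_mul_σ fun b => ?_
  rw [mul_sub, sub_mul, ← R.covariant, ← mul_assoc, ← map_mul, ← R.covariant, ← left_op_smul,
    sub_eq_zero]
  congr 1
  simp [left]

theorem T_op_smul (b : M) (ξ : E) : R.T (op b • ξ) = R.T ξ * R.σ b := by
  rw [← sub_eq_zero]
  refine R.eq_zero_of_σ_mul fun a => R.eq_zero_of_mul_σ fun c => ?_
  rw [mul_sub, sub_mul, ← R.covariant, ← mul_assoc, mul_assoc _ (R.σ b), ← map_mul,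
    ← R.covariant, op_smul_op_smul, sub_self]

/-- `ξ ⊗ h ↦ T(ξ) h` on the algebraic tensor product. -/
noncomputable def preT : PreTensor E R.σ →ₗ[ℂ] H :=
  TensorProduct.lift ((ContinuousLinearMap.coeLM ℂ).comp R.T)

theorem preT_tmul (ξ : E) (h : H) : R.preT (preTmul R.σ ξ h) = R.T ξ h := rfl

theorem preT_bound : ∃ C : ℝ, ∀ u, ‖R.preT u‖ ≤ C * ‖u‖ := by
  obtain ⟨C₀, hC₀⟩ := R.completelyBounded
  obtain ⟨C, hC0, hC⟩ : ∃ C : ℝ, 0 ≤ C ∧ ∀ (n : ℕ) (ξ : Fin n → Fin n → E) (h : Fin n → H),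
      ∑ i, ‖∑ j, R.T (ξ i j) (h j)‖ ^ 2 ≤ (C * matNorm M ξ) ^ 2 * ∑ j, ‖h j‖ ^ 2 :=
    ⟨|C₀|, abs_nonneg _, fun n ξ h => by
      have := hC₀ n ξ h
      rwa [mul_pow, ← sq_abs C₀, ← mul_pow] at this⟩
  have hrow : ∀ (n : ℕ) (ξ : Fin n → E) (h : Fin n → H),
      ‖∑ j, R.T (ξ j) (h j)‖ ^ 2 ≤ C ^ 2 * ‖gram M ξ‖ * ∑ j, ‖h j‖ ^ 2 := by
    intro n ξ h
    rcases n with _ | n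
    · simp
    have h1 := hC (n + 1) (fun i j => if i = 0 then ξ j else 0) h
    have h2 : matNorm M (fun i j => if i = 0 then ξ j else (0 : E)) = √‖gram M ξ‖ := by
      rw [matNorm, gram]
      congr 3
      ext i j
      rw [Finset.sum_eq_single (0 : Fin (n + 1))]
      · simp
      · intro k _ hk
        simp [hk, ip]
      · simp
    rw [h2, mul_pow, Real.sq_sqrt (norm_nonneg _)] at h1
    refine le_trans ?_ h1
    have h3 := Finset.single_le_sum (f := fun i : Fin (n + 1) =>
      ‖∑ j, R.T (if i = 0 then ξ j else 0) (h j)‖ ^ 2) (fun i _ => by positivity)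
      (Finset.mem_univ 0)
    simpa using h3
  have hone : ∀ (ξ : E) (h : H), ‖R.T ξ h‖ ≤ C * ‖ξ‖ * ‖h‖ := by
    intro ξ h
    have h1 := hrow 1 (fun _ => ξ) (fun _ => h)
    have h2 : ‖gram M (fun _ : Fin 1 => ξ)‖ ≤ ‖ξ‖ ^ 2 := by
      rw [norm_sq_eq_ip M]
      let e : M →⋆ₙₐ[ℂ] CStarMatrix (Fin 1) (Fin 1) M :=
        { toFun := fun a => CStarMatrix.ofMatrix fun _ _ => a
          map_smul' := fun c a => rfl
          map_zero' := rfl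
          map_add' := fun a b => rfl
          map_mul' := fun a b => by ext; simp [CStarMatrix.mul_apply]; rfl
          map_star' := fun a => rfl }
      exact NonUnitalStarAlgHom.norm_apply_le e (ip M ξ ξ)
    simp only [Finset.univ_unique, Finset.sum_singleton] at h1
    rw [← sq_le_sq₀ (by positivity) (by positivity), mul_pow, mul_pow]
    refine h1.trans ?_
    gcongr
  refine ⟨C, fun u => ?_⟩
  obtain ⟨n, ξ, h, rfl⟩ := preTensor_exists_sum R.σ u
  set G := gram M ξ with hG
  have key : ∀ δ : ℝ, 0 < δ → ‖R.preT (∑ i, preTmul R.σ (ξ i) (h i))‖ ≤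
      C * ‖∑ i, preTmul R.σ (ξ i) (h i)‖ + C * δ * ∑ i, ‖h i‖ := by
    intro δ hδ
    obtain ⟨s, a, hs, hsG, ha, haG, hb⟩ := exists_approx (gram_nonneg (M := M) ξ)
      (show 0 < δ ^ 2 by positivity)
    set ξ' := rowMul ξ a with hξ'
    set η := rowMul ξ' s with hη
    have hgζ : gram M (fun i => ξ i - η i) = G - s * a * G - G * a * s + s * a * G * a * s := by
      have e1 : gram M η = s * a * G * a * s := by
        rw [hη, gram_rowMul, hξ', gram_rowMul, hs, ha]; simp only [mul_assoc]; rfl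
      have e2 : ∀ i j, ip M (ξ i) (η j) = (G * a * s) i j := by
        intro i j
        simp only [hη, hξ', ip_rowMul_right, CStarMatrix.mul_apply]; rfl
      have e3 : ∀ i j, ip M (η i) (ξ j) = (s * a * G) i j := by
        intro i j
        rw [← hs, ← ha, mul_assoc]
        simp only [hη, hξ', ip_rowMul_left, CStarMatrix.mul_apply, CStarMatrix.star_apply]
        rfl
      ext i j
      have e1' : ip M (η i) (η j) = (s * a * G * a * s) i j := by rw [← e1]; rfl
      have : (G - s * a * G - G * a * s + s * a * G * a * s) i j =
          G i j - (s * a * G) i j - (G * a * s) i j + (s * a * G * a * s) i j := rfl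
      rw [this, gram_apply, ip_sub_left, ip_sub_right, ip_sub_right, e2, e3, e1']
      change G i j - _ - _ = _
      abel
    have hζ : ∀ i, ‖ξ i - η i‖ ≤ δ := by
      intro i
      rw [← sq_le_sq₀ (by positivity) (by positivity), norm_sq_eq_ip M]
      have : ip M (ξ i - η i) (ξ i - η i) = gram M (fun i => ξ i - η i) i i := rfl
      rw [this]
      refine CStarMatrix.norm_entry_le_norm.trans ?_
      rw [hgζ]
      exact hb
    have hξ'n : ‖gram M ξ'‖ ≤ 1 := by
      rw [hξ', gram_rowMul, ha]; exact haG
    set x : Fin n → H := fun k => ∑ l, R.σ (s k l) (h l) with hx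
    have hTη : ∑ l, R.T (η l) (h l) = ∑ k, R.T (ξ' k) (x k) := by
      simp only [hη, rowMul, map_sum, T_op_smul, _root_.sum_apply, hx]
      rw [Finset.sum_comm]
      rfl
    have hxn : ∑ k, ‖x k‖ ^ 2 = ‖∑ i, preTmul R.σ (ξ i) (h i)‖ ^ 2 := by
      rw [pre_norm_sq_sum R.σ ξ h (fun k l => s k l)]
      intro i j
      have : ip M (ξ i) (ξ j) = (star s * s) i j := by rw [hs, hsG]; rfl
      rw [this]
      simp [CStarMatrix.mul_apply, CStarMatrix.star_apply]
    have h1 : ‖∑ l, R.T (η l) (h l)‖ ≤ C * ‖∑ i, preTmul R.σ (ξ i) (h i)‖ := by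
      rw [← sq_le_sq₀ (by positivity) (by positivity), mul_pow, hTη, ← hxn]
      refine (hrow n ξ' x).trans ?_
      have : C ^ 2 * ‖gram M ξ'‖ ≤ C ^ 2 := mul_le_of_le_one_right (by positivity) hξ'n
      gcongr
    have h2 : ‖∑ l, R.T (ξ l - η l) (h l)‖ ≤ C * δ * ∑ i, ‖h i‖ := by
      rw [Finset.mul_sum]
      refine (norm_sum_le _ _).trans (Finset.sum_le_sum fun l _ => (hone _ _).trans ?_)
      gcongr
      exact hζ l
    have h3 : R.preT (∑ i, preTmul R.σ (ξ i) (h i)) =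
        ∑ l, R.T (η l) (h l) + ∑ l, R.T (ξ l - η l) (h l) := by
      rw [map_sum, ← Finset.sum_add_distrib]
      refine Finset.sum_congr rfl fun l _ => ?_
      rw [preT_tmul, map_sub, _root_.sub_apply, add_sub_cancel]
    rw [h3]
    exact (norm_add_le _ _).trans (add_le_add h1 h2)
  refine le_of_forall_pos_le_add fun ε hε => ?_
  have hD : 0 < C * ∑ i, ‖h i‖ + 1 := by positivity
  refine (key (ε / (C * ∑ i, ‖h i‖ + 1)) (by positivity)).trans ?_
  gcongr
  calc C * (ε / (C * ∑ i, ‖h i‖ + 1)) * ∑ i, ‖h i‖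
      = ε * ((C * ∑ i, ‖h i‖) / (C * ∑ i, ‖h i‖ + 1)) := by ring
    _ ≤ ε * 1 := by
      gcongr
      rw [div_le_one hD]
      linarith
    _ = ε := mul_one ε

/-- The bounded operator `T̃ : E ⊗_σ H → H`, `T̃ (ξ ⊗ h) = T(ξ) h`. -/
noncomputable def tilde : HTensor E R.σ →L[ℂ] H :=
  (R.preT.mkContinuousOfExistsBound R.preT_bound).fromCompletion

theorem tilde_tmul (ξ : E) (h : H) : R.tilde (tmul R.σ ξ h) = R.T ξ h := by
  rw [tilde, tmul, ContinuousLinearMap.fromCompletion_apply_coe]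
  rfl

theorem tilde_intertwines (a : M) (x : HTensor E R.σ) :
    R.tilde (tensorRep R.σ a x) = R.σ a (R.tilde x) := by
  have : R.tilde ∘L tensorRep R.σ a = R.σ a ∘L R.tilde :=
    htensor_ext R.σ fun ξ h => by
      simp [tensorRep_tmul, tilde_tmul, T_left]
  exact congr($this x)


/-- `I_E ⊗ T̃ : E ⊗ (E ⊗_σ H) → E ⊗_σ H`. -/
noncomputable def ampTilde : HTensor E (tensorRep (E := E) R.σ) →L[ℂ] HTensor E R.σ :=
  amp (tensorRep R.σ) R.σ R.tilde R.tilde_intertwines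

end CovRep

variable (M) in
/-- A Hilbert space with a representation of `M`. -/
structure HilbRep : Type (max w (v + 1)) where
  X : Type v
  [instNormed : NormedAddCommGroup X]
  [instInner : InnerProductSpace ℂ X]
  [instComplete : CompleteSpace X]
  π : M →⋆ₙₐ[ℂ] (X →L[ℂ] X)

attribute [instance] HilbRep.instNormed HilbRep.instInner HilbRep.instComplete

variable (E) in
/-- The Hilbert space `E^{⊗(n+1)} ⊗_σ H` with the representation `φ_{n+1}(a) ⊗ I`, built as
`E ⊗ (E ⊗ ( ⋯ (E ⊗_σ H)))` (associativity of the interior tensor product). Note the shift: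
the index `n` stands for the tensor power `n + 1`, so that `n : ℕ` runs through all powers `≥ 1`. -/
noncomputable def tensorPow [Correspondence M E] (σ : M →⋆ₙₐ[ℂ] (H →L[ℂ] H)) :
    ℕ → HilbRep.{w, max u v} M
  | 0 => ⟨HTensor E σ, tensorRep σ⟩
  | n + 1 => ⟨HTensor E (tensorPow σ n).π, tensorRep (tensorPow σ n).π⟩

namespace CovRep

variable [Correspondence M E] (R : CovRep M E H)

/-- The operators `T̃_{n+1}` together with their intertwining property. -/
noncomputable def tildePowAux : (n : ℕ) →
    {S : (tensorPow E R.σ n).X →L[ℂ] H // ∀ a x, S ((tensorPow E R.σ n).π a x) = R.σ a (S x)}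
  | 0 => ⟨R.tilde, R.tilde_intertwines⟩
  | n + 1 =>
    ⟨R.tilde ∘L amp (tensorPow E R.σ n).π R.σ (tildePowAux n).1 (tildePowAux n).2,
      fun a x => (congrArg R.tilde (amp_tensorRep (tensorPow E R.σ n).π R.σ (tildePowAux n).1
        (tildePowAux n).2 a x)).trans (R.tilde_intertwines a _)⟩

/-- The operator `T̃_{n+1} : E^{⊗(n+1)} ⊗_σ H → H`,
`T̃_{n+1} (ξ₁ ⊗ ⋯ ⊗ ξ_{n+1} ⊗ h) = T(ξ₁) ⋯ T(ξ_{n+1}) h`, that is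
`T̃_1 = T̃` and `T̃_{n+2} = T̃ (I_E ⊗ T̃_{n+1})`. -/
noncomputable def tildePow (n : ℕ) : (tensorPow E R.σ n).X →L[ℂ] H := (R.tildePowAux n).1

theorem tildePow_zero_tmul (ξ : E) (h : H) : R.tildePow 0 (tmul R.σ ξ h) = R.T ξ h :=
  R.tilde_tmul ξ h

theorem tildePow_succ_tmul (n : ℕ) (ξ : E) (x : (tensorPow E R.σ n).X) :
    R.tildePow (n + 1) (tmul (tensorPow E R.σ n).π ξ x) = R.T ξ (R.tildePow n x) := by
  change R.tilde (amp (tensorPow E R.σ n).π R.σ (R.tildePowAux n).1 (R.tildePowAux n).2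
    (tmul (tensorPow E R.σ n).π ξ x)) = _
  rw [amp_tmul, tilde_tmul]; rfl

/-- `(σ, T)` is concave: `‖T̃_2 u‖² + ‖u‖² ≤ 2 ‖(I_E ⊗ T̃) u‖²` for all `u` in
`E^{⊗2} ⊗_σ H` (here `tildePow 1` is `T̃_2`). -/
def IsConcave : Prop :=
  ∀ u : HTensor E (tensorRep (E := E) R.σ),
    ‖R.tildePow 1 u‖ ^ 2 + ‖u‖ ^ 2 ≤ 2 * ‖R.ampTilde u‖ ^ 2

/-- `(σ, T)` is analytic: the intersection over `n ≥ 1` of the ranges of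
`T̃_n : E^{⊗n} ⊗_σ H → H` is zero. -/
def IsAnalytic : Prop := ⨅ n : ℕ, (R.tildePow n).range = ⊥

/-- `(σ, T)`-invariant closed subspaces. -/
structure IsInvariant (K : Submodule ℂ H) : Prop where
  isClosed : IsClosed (K : Set H)
  σ_mem : ∀ a, ∀ h ∈ K, R.σ a h ∈ K
  T_mem : ∀ ξ, ∀ h ∈ K, R.T ξ h ∈ K

/-- `𝔏_n(W)`, the closed linear span of the vectors `T(ξ₁) ⋯ T(ξ_n) h` with `h ∈ W`; for `n = 0`
this is the closure of `W`, that is `W` itself when `W` is closed. -/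
def wordSpan (n : ℕ) (W : Submodule ℂ H) : Submodule ℂ H :=
  (Submodule.span ℂ {k : H | ∃ (ξ : Fin n → E), ∃ h ∈ W,
    (List.ofFn fun i => R.T (ξ i)).prod h = k}).topologicalClosure

/-- `⋁_{n ≥ 0} 𝔏_n(W)`. -/
def generated (W : Submodule ℂ H) : Submodule ℂ H :=
  (⨆ n : ℕ, R.wordSpan n W).topologicalClosure

/-- Wandering subspaces for `(σ, T)`: closed `σ(M)`-invariant subspaces `W` orthogonal to `𝔏_n(W)`
for all `n ≥ 1`. -/
structure IsWandering (W : Submodule ℂ H) : Prop where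
  isClosed : IsClosed (W : Set H)
  σ_mem : ∀ a, ∀ h ∈ W, R.σ a h ∈ W
  isOrtho : ∀ n : ℕ, 1 ≤ n → W ⟂ R.wordSpan n W

/-- `E ⊗ K` as a closed subspace of `E ⊗_σ H`: the closed linear span of the `ξ ⊗ h`, `h ∈ K`. -/
noncomputable def tensorSub (K : Submodule ℂ H) : Submodule ℂ (HTensor E R.σ) :=
  (Submodule.span ℂ {x | ∃ (ξ : E), ∃ h ∈ K, tmul R.σ ξ h = x}).topologicalClosure

/-- The subspace `K ⊖ T̃(E ⊗ K)`. -/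
noncomputable def defect (K : Submodule ℂ H) : Submodule ℂ H :=
  K ⊓ ((R.tensorSub K).map (R.tilde : HTensor E R.σ →ₗ[ℂ] H))ᗮ

/-- The kernel of `T̃⋆`. -/
noncomputable def kerAdjoint : Submodule ℂ H := (ContinuousLinearMap.adjoint R.tilde).ker

/-- `(σ, T)` has the generating wandering subspace property: `ker T̃⋆` is wandering and
`H = ⋁_{n ≥ 0} 𝔏_n(ker T̃⋆)`. -/
def HasGeneratingWanderingSubspace : Prop :=
  R.IsWandering R.kerAdjoint ∧ R.generated R.kerAdjoint = ⊤

end CovRep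

end Covariant

end CStarCorr

namespace CStarCorr

open scoped TensorProduct InnerProductSpace
open MulOpposite

set_option linter.unusedSectionVars false

universe w u v

/-! ### Amplifications `I_E ⊗ S`: transfer of inequalities to and from the interior tensor product.
-/

section Amplification

variable {M : Type*} [NonUnitalCStarAlgebra M] [PartialOrder M] [StarOrderedRing M]
  {E : Type*} [NormedAddCommGroup E] [NormedSpace ℂ E] [SMul Mᵐᵒᵖ E] [CStarModule Mᵐᵒᵖ E]
  {X : Type*} [NormedAddCommGroup X] [InnerProductSpace ℂ X] [CompleteSpace X]
  {Y : Type*} [NormedAddCommGroup Y] [InnerProductSpace ℂ Y] [CompleteSpace Y]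
  {Z : Type*} [NormedAddCommGroup Z] [InnerProductSpace ℂ Z] [CompleteSpace Z]
  (π : M →⋆ₙₐ[ℂ] (X →L[ℂ] X)) (ρ : M →⋆ₙₐ[ℂ] (Y →L[ℂ] Y)) (τ : M →⋆ₙₐ[ℂ] (Z →L[ℂ] Z))

/-! The argument treats a bare concave intertwiner `S : E ⊗_π X → X` rather than a covariant
representation, so that it applies directly to the restriction of `T̃` to an invariant subspace.

Expansivity. Concavity only compares `S (I ⊗ S)`, `I ⊗ S` and the identity. Suppose `c ‖u‖² ≤ ‖S
u‖²`. Inserted into concavity this bounds `‖(I ⊗ S) u‖²` below by `‖u‖² / (2 - c)`, and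
`lower_bound_of_amp` strips off the factor `I_E`. Starting from `c = 0`, the iteration gives `c = n
/ (n + 1)`, hence `‖u‖ ≤ ‖S u‖` in the limit (`norm_le_of_concave`). Removing `I_E` is where the
inner products of `E` must act essentially; the condition is needed on `E ⊗_π X` only, so nothing is
asked of `π`.

Wold argument. Put `L = (S⋆ S)⁻¹ S⋆`; then `S L` is the orthogonal projection onto the range of `S`,
and `x - S L x ∈ ker S⋆`. Let `S_n` and `L_n` be the iterates of `S` and `L`. Telescoping puts `x -
S_n L_n x` into every closed invariant subspace `V ⊇ ker S⋆`. The concavity estimate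
`norm_iter_sq_le` grows linearly in `n`, while the defects it multiplies are summable, so divergence
of the harmonic series keeps `‖S_n L_n x‖` bounded along a subsequence (`exists_iter_lift_bounded`).
If `x ⟂ V`, then `⟪x, S_n L_n x⟫ = ‖x‖²`. Analyticity makes the union of the complements of the
ranges of `S_n` dense; a vector `y` in this union is orthogonal to `S_n L_n x` for large `n`.
Letting `y` approach `x` forces `x = 0` (`eq_top_of_ker_adjoint_le`).

Concavity and analyticity pass to an invariant `K` because `E ⊗ K` embeds isometrically in `E ⊗_σ
H`. Wandering is elementary: every word of positive length sends the defect space into `T̃(E ⊗ K)`.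
-/

theorem amp_coe (S : X →L[ℂ] Y) (hS : ∀ a x, S (π a x) = ρ a (S x)) (u : PreTensor E π) :
    amp π ρ S hS (u : HTensor E π) = (preAmp π ρ S u : PreTensor E ρ) :=
  ContinuousLinearMap.completion_apply_coe _ _

/-- Quadratic inequalities between intertwiners pass to their amplifications. -/
theorem amp_quad (A : X →L[ℂ] Y) (hA : ∀ a x, A (π a x) = ρ a (A x))
    (B : X →L[ℂ] Z) (hB : ∀ a x, B (π a x) = τ a (B x)) (α β γ : ℝ)
    (h : ∀ x, 0 ≤ α * ‖A x‖ ^ 2 + β * ‖B x‖ ^ 2 + γ * ‖x‖ ^ 2) (u : HTensor E π) :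
    0 ≤ α * ‖amp π ρ A hA u‖ ^ 2 + β * ‖amp π τ B hB u‖ ^ 2 + γ * ‖u‖ ^ 2 := by
  induction u using UniformSpace.Completion.induction_on with
  | hp => exact isClosed_le continuous_const (by fun_prop)
  | ih u =>
    obtain ⟨n, ξ, x, rfl⟩ := preTensor_exists_sum π u
    -- All three squared norms are sums over `k` of squared norms at the same vectors `∑ j, π (C k
    -- j) (x j)`, so the hypothesis applies term by term.
    obtain ⟨C, hC⟩ := exists_gram_factor (M := M) ξ
    simp only [amp_coe, UniformSpace.Completion.norm_coe]
    rw [map_sum, map_sum]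
    simp only [preAmp_tmul]
    rw [pre_norm_sq_sum ρ ξ _ C hC, pre_norm_sq_sum τ ξ _ C hC, pre_norm_sq_sum π ξ x C hC]
    simp only [← hA, ← hB, Finset.mul_sum, ← map_sum]
    rw [← Finset.sum_add_distrib, ← Finset.sum_add_distrib]
    exact Finset.sum_nonneg fun k _ => h _

theorem amp_comp [Correspondence M E] (A : X →L[ℂ] Y) (hA : ∀ a x, A (π a x) = ρ a (A x))
    (B : Y →L[ℂ] Z) (hB : ∀ a x, B (ρ a x) = τ a (B x))
    (C : X →L[ℂ] Z) (hC : ∀ a x, C (π a x) = τ a (C x)) (h : ∀ x, B (A x) = C x)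
    (u : HTensor E π) : amp ρ τ B hB (amp π ρ A hA u) = amp π τ C hC u := by
  have : amp ρ τ B hB ∘L amp (E := E) π ρ A hA = amp π τ C hC :=
    htensor_ext π fun ξ x => by simp [amp_tmul, h]
  exact congr($this u)

theorem norm_amp_le (A : X →L[ℂ] Y) (hA : ∀ a x, A (π a x) = ρ a (A x))
    (h : ∀ x, ‖A x‖ ≤ ‖x‖) (u : HTensor E π) : ‖amp π ρ A hA u‖ ≤ ‖u‖ := by
  have := amp_quad π ρ ρ A hA A hA (-1) 0 1
    (fun x => by linarith [pow_le_pow_left₀ (norm_nonneg _) (h x) 2]) u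
  exact le_of_sq_le_sq (by linarith) (norm_nonneg _)

theorem le_norm_amp (A : X →L[ℂ] Y) (hA : ∀ a x, A (π a x) = ρ a (A x))
    (h : ∀ x, ‖x‖ ≤ ‖A x‖) (u : HTensor E π) : ‖u‖ ≤ ‖amp π ρ A hA u‖ := by
  have := amp_quad π ρ ρ A hA A hA 1 0 (-1)
    (fun x => by linarith [pow_le_pow_left₀ (norm_nonneg _) (h x) 2]) u
  exact le_of_sq_le_sq (by linarith) (norm_nonneg _)

/-- Only the composite is assumed contractive, so the two amplifications are merged before the bound
is amplified. -/
theorem norm_amp_amp_le [Correspondence M E] (A : X →L[ℂ] Y) (hA : ∀ a x, A (π a x) = ρ a (A x))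
    (B : Y →L[ℂ] X) (hB : ∀ a x, B (ρ a x) = π a (B x)) (h : ∀ x, ‖B (A x)‖ ≤ ‖x‖)
    (u : HTensor E π) : ‖amp ρ π B hB (amp π ρ A hA u)‖ ≤ ‖u‖ := by
  have hBA : ∀ a x, (B ∘L A) (π a x) = π a ((B ∘L A) x) := fun a x => by simp [hA, hB]
  rw [amp_comp π ρ π A hA B hB (B ∘L A) hBA fun _ => rfl]
  exact norm_amp_le π π _ _ h u

theorem amp_amp_concave [Correspondence M E] (A : X →L[ℂ] Y) (hA : ∀ a x, A (π a x) = ρ a (A x))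
    (B : Y →L[ℂ] Z) (hB : ∀ a x, B (ρ a x) = τ a (B x))
    (h : ∀ x, ‖B (A x)‖ ^ 2 + ‖x‖ ^ 2 ≤ 2 * ‖A x‖ ^ 2) (u : HTensor E π) :
    ‖amp ρ τ B hB (amp π ρ A hA u)‖ ^ 2 + ‖u‖ ^ 2 ≤ 2 * ‖amp π ρ A hA u‖ ^ 2 := by
  have hBA : ∀ a x, (B ∘L A) (π a x) = τ a ((B ∘L A) x) := fun a x => by simp [hA, hB]
  rw [amp_comp π ρ τ A hA B hB (B ∘L A) hBA fun _ => rfl]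
  have := amp_quad π τ ρ (B ∘L A) hBA A hA (-1) 2 (-1)
    (fun x => by rw [ContinuousLinearMap.comp_apply]; linarith [h x]) u
  linarith

theorem norm_tmul_sq (ξ : E) (x : X) : ‖tmul π ξ x‖ ^ 2 = (⟪x, π (ip M ξ ξ) x⟫_ℂ).re := by
  rw [← inner_tmul_tmul, inner_self_eq_norm_sq_to_K]
  norm_cast

theorem norm_tmul_le (ξ : E) (x : X) : ‖tmul π ξ x‖ ≤ ‖ξ‖ * ‖x‖ := by
  refine le_of_sq_le_sq ?_ (by positivity)
  rw [norm_tmul_sq, mul_pow, norm_sq_eq_ip M ξ]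
  calc _ ≤ ‖⟪x, π (ip M ξ ξ) x⟫_ℂ‖ := Complex.re_le_norm _
    _ ≤ ‖x‖ * ‖π (ip M ξ ξ) x‖ := norm_inner_le_norm _ _
    _ ≤ ‖x‖ * (‖ip M ξ ξ‖ * ‖x‖) := by
      gcongr
      refine ((π (ip M ξ ξ)).le_opNorm x).trans ?_
      gcongr
      exact NonUnitalStarAlgHom.norm_apply_le π _
    _ = _ := by ring

/-- The elementary tensor `ξ ⊗ x` as a bounded bilinear map. -/
noncomputable def tmulL : E →L[ℂ] X →L[ℂ] HTensor E π :=
  LinearMap.mkContinuous₂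
    (LinearMap.mk₂ ℂ (tmul π)
      (fun a b x => by
        simp only [tmul, preTmul, TensorProduct.add_tmul]
        exact UniformSpace.Completion.coe_add _ _)
      (fun c a x => by
        simp only [tmul, preTmul, ← TensorProduct.smul_tmul']
        exact UniformSpace.Completion.coe_smul c (preTmul π a x))
      (fun a x y => by
        simp only [tmul, preTmul, TensorProduct.tmul_add]
        exact UniformSpace.Completion.coe_add _ _)
      (fun c a x => by
        simp only [tmul, preTmul, TensorProduct.tmul_smul]
        exact UniformSpace.Completion.coe_smul c (preTmul π a x)))
    1 (fun ξ x => by simpa using norm_tmul_le π ξ x)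

theorem tmulL_apply (ξ : E) (x : X) : tmulL π ξ x = tmul π ξ x := rfl

/-- A closed subspace that contains the elementary tensors is everything. -/
theorem htensor_mem {V : Submodule ℂ (HTensor E π)} (hV : IsClosed (V : Set (HTensor E π)))
    (h : ∀ (ξ : E) x, tmul π ξ x ∈ V) (u : HTensor E π) : u ∈ V := by
  induction u using UniformSpace.Completion.induction_on with
  | hp => exact hV
  | ih u =>
    induction u using preTensor_induction with
    | tmul ξ x => exact h ξ x
    | add x y hx hy =>
      rw [UniformSpace.Completion.coe_add]
      exact V.add_mem hx hy

theorem htensor_sub_mem {V : Submodule ℂ Y} (hV : IsClosed (V : Set Y)) (A B : HTensor E π →L[ℂ] Y)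
    (h : ∀ (ξ : E) x, A (tmul π ξ x) - B (tmul π ξ x) ∈ V) (u : HTensor E π) : A u - B u ∈ V :=
  htensor_mem π (V := V.comap ((A - B : HTensor E π →L[ℂ] Y) : HTensor E π →ₗ[ℂ] Y))
    (hV.preimage (A - B).continuous) h u

theorem inner_rep_left (a : M) (x y : X) : ⟪π a x, y⟫_ℂ = ⟪x, π (star a) y⟫_ℂ := by
  rw [map_star, ContinuousLinearMap.star_eq_adjoint, ContinuousLinearMap.adjoint_inner_right]

theorem adjoint_intertwines (S : X →L[ℂ] Y) (hS : ∀ a x, S (π a x) = ρ a (S x)) (a : M) (y : Y) :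
    ContinuousLinearMap.adjoint S (ρ a y) = π a (ContinuousLinearMap.adjoint S y) := by
  refine ext_inner_right ℂ fun x => ?_
  rw [ContinuousLinearMap.adjoint_inner_left, inner_rep_left, inner_rep_left, ← hS,
    ContinuousLinearMap.adjoint_inner_left]

variable (E) in
/-- If `π` is essential on the ideal generated by the inner products of `E`, then a lower bound
for `I_E ⊗ S` is one for `S`. -/
theorem lower_bound_of_amp
    (hπ : (Submodule.span ℂ {y : X | ∃ (ξ η : E) (x : X), π (ip M ξ η) x = y}).topologicalClosure
      = ⊤)
    (S : X →L[ℂ] Y) (hS : ∀ a x, S (π a x) = ρ a (S x)) (c : ℝ)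
    (h : ∀ u : HTensor E π, c * ‖u‖ ^ 2 ≤ ‖amp π ρ S hS u‖ ^ 2) (x : X) :
    c * ‖x‖ ^ 2 ≤ ‖S x‖ ^ 2 := by
  -- `D = S⋆ S - c` lies in the commutant of `π`; the goal is `0 ≤ D`.
  set D : X →L[ℂ] X := ContinuousLinearMap.adjoint S ∘L S - (c : ℂ) • 1 with hD
  have hDx : ∀ x y, ⟪D x, y⟫_ℂ = ⟪S x, S y⟫_ℂ - c * ⟪x, y⟫_ℂ := by
    intro x y
    simp [hD, ContinuousLinearMap.adjoint_inner_left]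
  have hDsa : IsSelfAdjoint D := by
    rw [ContinuousLinearMap.isSelfAdjoint_iff_isSymmetric]
    intro x y
    change ⟪D x, y⟫_ℂ = ⟪x, D y⟫_ℂ
    rw [← inner_conj_symm x, hDx, hDx]
    simp [inner_conj_symm]
  have hDc : ∀ a, Commute D (π a) := by
    intro a
    ext x
    simp [hD, hS, adjoint_intertwines π ρ S hS]
  -- `N` is the negative part of `D` and `K` its square root; as functions of `D` both commute with
  -- `π`.
  set K : X →L[ℂ] X := cfc (fun t : ℝ => √(max (-t) 0)) D with hK
  set N : X →L[ℂ] X := cfc (fun t : ℝ => max (-t) 0) D with hN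
  have hKsa : IsSelfAdjoint K := cfc_predicate _ D
  have hNsa : IsSelfAdjoint N := cfc_predicate _ D
  have hKc : ∀ a, Commute K (π a) := fun a => (hDc a).cfc_real _
  have hNc : ∀ a, Commute N (π a) := fun a => (hDc a).cfc_real _
  have hKDK : K * D * K = -(N * N) := by
    rw [hK, hN]
    nth_rw 2 [← cfc_id' ℝ D]
    rw [← cfc_mul _ _ D, ← cfc_mul _ _ D, ← cfc_mul _ _ D, ← cfc_neg]
    refine cfc_congr fun t _ => ?_
    have h1 : √(max (-t) 0) * √(max (-t) 0) = max (-t) 0 :=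
      Real.mul_self_sqrt (le_max_right _ _)
    rw [mul_right_comm]
    simp only [h1]
    rcases le_total 0 t with ht | ht
    · simp [ht]
    · rw [max_eq_left (by linarith)]; ring
  have hsym : ∀ {B : X →L[ℂ] X}, IsSelfAdjoint B → ∀ x y, ⟪B x, y⟫_ℂ = ⟪x, B y⟫_ℂ :=
    fun hB => (ContinuousLinearMap.isSelfAdjoint_iff_isSymmetric.mp hB)
  have hNz : ∀ (ξ : E) x, tmul π ξ (N x) = 0 := by
    intro ξ x
    -- On `ξ ⊗ K x` the form of `I ⊗ D` equals `-‖ξ ⊗ N x‖²` because `K D K = -N²`, while the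
    -- hypothesis makes it nonnegative.
    have h1 := h (tmul π ξ (K x))
    rw [amp_tmul, norm_tmul_sq, norm_tmul_sq, ← hS] at h1
    have h2 : ⟪S (K x), S (π (ip M ξ ξ) (K x))⟫_ℂ - c * ⟪K x, π (ip M ξ ξ) (K x)⟫_ℂ
        = -⟪N x, π (ip M ξ ξ) (N x)⟫_ℂ := by
      rw [← hDx]
      have e1 : π (ip M ξ ξ) (K x) = K (π (ip M ξ ξ) x) :=
        congr($((hKc (ip M ξ ξ)).eq) x).symm
      have e2 : π (ip M ξ ξ) (N x) = N (π (ip M ξ ξ) x) :=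
        congr($((hNc (ip M ξ ξ)).eq) x).symm
      rw [e1, e2, ← hsym hKsa, ← hsym hNsa, ← inner_neg_left]
      congr 1
      exact congr($hKDK x)
    have h3 := congrArg Complex.re h2
    rw [Complex.sub_re, Complex.neg_re, Complex.re_ofReal_mul, ← norm_tmul_sq π ξ (N x)] at h3
    have h4 : ‖tmul π ξ (N x)‖ ^ 2 = 0 := le_antisymm (by linarith) (by positivity)
    simpa using h4
  have hN0 : N = 0 := by
    -- Since `⟪y, π(⟨ξ, η⟩) N x⟫ = ⟪ξ ⊗ y, η ⊗ N x⟫ = 0` and `N` commutes with `π`, the kernel of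
    -- `N` contains the dense span in `hπ`.
    have h1 : (Submodule.span ℂ {y : X | ∃ (ξ η : E) (x : X), π (ip M ξ η) x = y}) ≤ N.ker := by
      rw [Submodule.span_le]
      rintro _ ⟨ξ, η, x, rfl⟩
      refine ext_inner_left ℂ fun y => ?_
      change ⟪y, N (π (ip M ξ η) x)⟫_ℂ = _
      have e : N (π (ip M ξ η) x) = π (ip M ξ η) (N x) := congr($((hNc (ip M ξ η)).eq) x)
      rw [e, ← inner_tmul_tmul, hNz, inner_zero_right, inner_zero_right]
    have h2 := Submodule.topologicalClosure_minimal _ h1 N.isClosed_ker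
    rw [hπ] at h2
    ext x
    exact h2 (Submodule.mem_top (x := x))
  have hD0 : 0 ≤ D := by
    have h1 : D = cfc (fun t : ℝ => max t 0) D := by
      conv_lhs => rw [← cfc_id' ℝ D, ← sub_zero (cfc (fun t : ℝ => t) D)]
      rw [← neg_zero, ← hN0, hN, ← cfc_neg, ← cfc_sub _ _ D]
      refine cfc_congr fun t _ => ?_
      rcases le_total 0 t with ht | ht
      · simp [ht]
      · simp [ht]
    rw [h1]
    exact cfc_nonneg fun t _ => le_max_right _ _
  have h5 := ((ContinuousLinearMap.nonneg_iff_isPositive _).mp hD0).re_inner_nonneg_left x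
  change 0 ≤ (⟪D x, x⟫_ℂ).re at h5
  rw [hDx, Complex.sub_re, Complex.re_ofReal_mul] at h5
  have e1 : (⟪S x, S x⟫_ℂ).re = ‖S x‖ ^ 2 := by rw [inner_self_eq_norm_sq_to_K]; norm_cast
  have e2 : (⟪x, x⟫_ℂ).re = ‖x‖ ^ 2 := by rw [inner_self_eq_norm_sq_to_K]; norm_cast
  rw [e1, e2] at h5
  linarith

variable [Correspondence M E]

/-- Density of the vectors `φ(⟨ξ, η⟩) ζ` in `E` carries over through the continuous maps `ζ ↦ ζ ⊗
x`. This provides the essentiality condition of `lower_bound_of_amp` on `E ⊗_π X`, for arbitrary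
`π`. -/
theorem tensorRep_essential (hE : InnerEssential M E) :
    (Submodule.span ℂ {y : HTensor E π | ∃ (ξ η : E) (x : HTensor E π),
      tensorRep π (ip M ξ η) x = y}).topologicalClosure = ⊤ := by
  rw [eq_top_iff]
  intro u _
  refine htensor_mem π (Submodule.isClosed_topologicalClosure _) (fun ζ x => ?_) u
  set V := (Submodule.span ℂ {y : HTensor E π | ∃ (ξ η : E) (x : HTensor E π),
      tensorRep π (ip M ξ η) x = y}).topologicalClosure with hV
  have h1 : Submodule.span ℂ {z : E | ∃ ξ η ζ : E, left (ip M ξ η) ζ = z} ≤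
      V.comap (((tmulL π).flip x : E →L[ℂ] HTensor E π) : E →ₗ[ℂ] HTensor E π) := by
    rw [Submodule.span_le]
    rintro _ ⟨ξ, η, ζ, rfl⟩
    refine Submodule.le_topologicalClosure _ (Submodule.subset_span ⟨ξ, η, tmul π ζ x, ?_⟩)
    rw [tensorRep_tmul]; rfl
  have h2 := Submodule.topologicalClosure_minimal _ h1
    ((Submodule.isClosed_topologicalClosure _).preimage ((tmulL π).flip x).continuous)
  rw [show _ = _ from hE] at h2
  exact h2 (Submodule.mem_top (x := ζ))

end Amplification

/-! ### Concave intertwiners: expansivity, left inverse and the Wold-type argument. -/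

section Wold

variable {M : Type w} [NonUnitalCStarAlgebra M] [PartialOrder M] [StarOrderedRing M]
  {E : Type u} [NormedAddCommGroup E] [NormedSpace ℂ E] [SMul Mᵐᵒᵖ E] [CStarModule Mᵐᵒᵖ E]
  [Correspondence M E]
  {X : Type v} [NormedAddCommGroup X] [InnerProductSpace ℂ X] [CompleteSpace X]
  (π : M →⋆ₙₐ[ℂ] (X →L[ℂ] X))
  (S : HTensor E π →L[ℂ] X) (hS : ∀ a u, S (tensorRep π a u) = π a (S u))

/-- A concave intertwiner `S : E ⊗_π X → X` is expansive. -/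
theorem norm_le_of_concave (hE : InnerEssential M E)
    (hc : ∀ u : HTensor E (tensorRep (E := E) π),
      ‖S (amp (tensorRep π) π S hS u)‖ ^ 2 + ‖u‖ ^ 2 ≤ 2 * ‖amp (tensorRep π) π S hS u‖ ^ 2)
    (u : HTensor E π) : ‖u‖ ≤ ‖S u‖ := by
  -- The constants are the orbit of `0` under `c ↦ 1 / (2 - c)`, which increases to the fixed point
  -- `1`.
  have key : ∀ n : ℕ, ∀ u : HTensor E π, ((n : ℝ) / (n + 1)) * ‖u‖ ^ 2 ≤ ‖S u‖ ^ 2 := by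
    intro n
    induction n with
    | zero => intro u; simp
    | succ n ih =>
      refine lower_bound_of_amp E (tensorRep π) π (tensorRep_essential π hE) S hS _ fun u => ?_
      have h1 := ih (amp (tensorRep π) π S hS u)
      have h2 := hc u
      push_cast
      set p := ‖amp (tensorRep π) π S hS u‖ ^ 2
      have h3 : ((n : ℝ) / (n + 1)) * p + ‖u‖ ^ 2 ≤ 2 * p := by linarith
      rw [div_mul_eq_mul_div, div_le_iff₀ (by positivity)]
      rw [div_mul_eq_mul_div, div_add' _ _ _ (by positivity), div_le_iff₀ (by positivity)] at h3
      linarith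
  refine le_of_sq_le_sq ?_ (norm_nonneg _)
  have h1 : Filter.Tendsto (fun n : ℕ => ((n : ℝ) / (n + 1)) * ‖u‖ ^ 2) Filter.atTop
      (nhds (1 * ‖u‖ ^ 2)) := tendsto_natCast_div_add_atTop (1 : ℝ) |>.mul_const _
  rw [one_mul] at h1
  exact le_of_tendsto' h1 fun n => key n u

/-- An expansive intertwiner `S` has an intertwining left inverse `(S⋆ S)⁻¹ S⋆`. -/
theorem exists_leftInverse (hS : ∀ a u, S (tensorRep π a u) = π a (S u)) (h : ∀ u, ‖u‖ ≤ ‖S u‖) :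
    ∃ L : X →L[ℂ] HTensor E π, (∀ a x, L (π a x) = tensorRep π a (L x)) ∧
      (∀ x, ‖S (L x)‖ ≤ ‖x‖) ∧
      ∀ x, x - S (L x) ∈ (ContinuousLinearMap.adjoint S).ker := by
  set P : HTensor E π →L[ℂ] HTensor E π := ContinuousLinearMap.adjoint S ∘L S with hP
  have hP1 : 1 ≤ P := by
    rw [ContinuousLinearMap.le_def, ContinuousLinearMap.isPositive_def]
    constructor
    · rw [← ContinuousLinearMap.isSelfAdjoint_iff_isSymmetric]
      refine IsSelfAdjoint.sub ?_ (IsSelfAdjoint.one _)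
      exact (ContinuousLinearMap.isPositive_adjoint_comp_self S).isSelfAdjoint
    · intro u
      rw [ContinuousLinearMap.reApplyInnerSelf_apply, _root_.sub_apply, inner_sub_left, hP,
        ContinuousLinearMap.comp_apply, ContinuousLinearMap.adjoint_inner_left,
        inner_self_eq_norm_sq_to_K, one_apply_eq_self, inner_self_eq_norm_sq_to_K]
      have := pow_le_pow_left₀ (norm_nonneg _) (h u) 2
      norm_cast
      simpa using this
  -- Expansivity says `S⋆ S ≥ 1`, so `S⋆ S` is invertible.
  have hPu : IsUnit P := CStarAlgebra.isUnit_of_le 1 hP1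
  obtain ⟨P', hP'⟩ := hPu
  set G : HTensor E π →L[ℂ] HTensor E π := ↑P'⁻¹
  have hGP : G * P = 1 := by rw [← hP']; exact P'.inv_mul
  have hPG : P * G = 1 := by rw [← hP']; exact P'.mul_inv
  have hker : ∀ x, x - S (G (ContinuousLinearMap.adjoint S x)) ∈
      (ContinuousLinearMap.adjoint S).ker := by
    intro x
    change ContinuousLinearMap.adjoint S _ = 0
    rw [map_sub, sub_eq_zero]
    exact congr($hPG (ContinuousLinearMap.adjoint S x)).symm
  refine ⟨G ∘L ContinuousLinearMap.adjoint S, ?_, ?_, hker⟩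
  · intro a x
    have hcomm : G * tensorRep π a = tensorRep π a * G := by
      have h1 : P * tensorRep π a = tensorRep π a * P := by
        ext u
        simp [hP, hS, adjoint_intertwines _ _ S hS]
      calc G * tensorRep π a = G * (tensorRep π a * P) * G := by
            rw [mul_assoc, mul_assoc, hPG, mul_one]
        _ = tensorRep π a * G := by rw [← h1, ← mul_assoc, hGP, one_mul]
    simp only [ContinuousLinearMap.comp_apply, adjoint_intertwines _ _ S hS]
    exact congr($hcomm (ContinuousLinearMap.adjoint S x))
  · intro x
    set y := G (ContinuousLinearMap.adjoint S x)
    -- The residual in `ker S⋆` is orthogonal to the range of `S`, so Pythagoras shows that `S L` is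
    -- a contraction.
    have h1 : ⟪x - S y, S y⟫_ℂ = 0 := by
      have : ContinuousLinearMap.adjoint S (x - S y) = 0 := hker x
      rw [← ContinuousLinearMap.adjoint_inner_left, this, inner_zero_left]
    have h2 := norm_add_sq_eq_norm_sq_add_norm_sq_of_inner_eq_zero (x - S y) (S y) h1
    rw [sub_add_cancel] at h2
    change ‖S y‖ ≤ ‖x‖
    nlinarith [norm_nonneg x, norm_nonneg (S y), mul_self_nonneg ‖x - S y‖]

/-- The iterates `S (I ⊗ S) ⋯ (I ⊗ ⋯ ⊗ I ⊗ S) : E^{⊗(n+1)} ⊗ X → X`. -/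
noncomputable def iter : (n : ℕ) →
    {T : (tensorPow E π n).X →L[ℂ] X // ∀ a x, T ((tensorPow E π n).π a x) = π a (T x)}
  | 0 => ⟨S, hS⟩
  | n + 1 => ⟨S ∘L amp (tensorPow E π n).π π (iter n).1 (iter n).2,
      fun a x => (congrArg S (amp_tensorRep (tensorPow E π n).π π (iter n).1
        (iter n).2 a x)).trans (hS a _)⟩

/-- `I ⊗ ⋯ ⊗ I ⊗ S : E^{⊗(n+2)} ⊗ X → E^{⊗(n+1)} ⊗ X`. -/
noncomputable def lower : (n : ℕ) →
    {U : (tensorPow E π (n + 1)).X →L[ℂ] (tensorPow E π n).X //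
      ∀ a x, U ((tensorPow E π (n + 1)).π a x) = (tensorPow E π n).π a (U x)}
  | 0 => ⟨amp (tensorRep π) π S hS, amp_tensorRep (tensorRep π) π S hS⟩
  | n + 1 => ⟨amp (tensorPow E π (n + 1)).π (tensorPow E π n).π (lower n).1 (lower n).2,
      amp_tensorRep (tensorPow E π (n + 1)).π (tensorPow E π n).π (lower n).1 (lower n).2⟩

variable (L : X →L[ℂ] HTensor E π) (hL : ∀ a x, L (π a x) = tensorRep π a (L x))

/-- `I ⊗ ⋯ ⊗ I ⊗ L : E^{⊗(n+1)} ⊗ X → E^{⊗(n+2)} ⊗ X`. -/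
noncomputable def raise : (n : ℕ) →
    {V : (tensorPow E π n).X →L[ℂ] (tensorPow E π (n + 1)).X //
      ∀ a x, V ((tensorPow E π n).π a x) = (tensorPow E π (n + 1)).π a (V x)}
  | 0 => ⟨amp π (tensorRep π) L hL, amp_tensorRep π (tensorRep π) L hL⟩
  | n + 1 => ⟨amp (tensorPow E π n).π (tensorPow E π (n + 1)).π (raise n).1 (raise n).2,
      amp_tensorRep (tensorPow E π n).π (tensorPow E π (n + 1)).π (raise n).1 (raise n).2⟩

/-- `iter` is built by recursion at the outermost tensor factor and `lower` acts at the innermost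
one; this lemma peels `S` off from the inside. -/
theorem iter_lower (n : ℕ) (u : (tensorPow E π (n + 1)).X) :
    (iter π S hS n).1 ((lower π S hS n).1 u) = (iter π S hS (n + 1)).1 u := by
  induction n with
  | zero => rfl
  | succ n ih =>
    exact congrArg S (amp_comp (tensorPow E π (n + 1)).π (tensorPow E π n).π π
      (lower π S hS n).1 (lower π S hS n).2 (iter π S hS n).1 (iter π S hS n).2
      (iter π S hS (n + 1)).1 (iter π S hS (n + 1)).2 ih u)

theorem norm_le_iter (h : ∀ u, ‖u‖ ≤ ‖S u‖) (n : ℕ) (u : (tensorPow E π n).X) :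
    ‖u‖ ≤ ‖(iter π S hS n).1 u‖ := by
  induction n with
  | zero => exact h u
  | succ n ih =>
    exact (le_norm_amp (tensorPow E π n).π π (iter π S hS n).1 (iter π S hS n).2 ih u).trans (h _)

theorem norm_le_lower (h : ∀ u, ‖u‖ ≤ ‖S u‖) (n : ℕ) (u : (tensorPow E π (n + 1)).X) :
    ‖u‖ ≤ ‖(lower π S hS n).1 u‖ := by
  induction n with
  | zero => exact le_norm_amp (tensorRep π) π S hS h u
  | succ n ih => exact le_norm_amp _ _ (lower π S hS n).1 (lower π S hS n).2 ih u

/-- The operator is `S L` amplified by `n + 1` copies of `I_E`, and amplification preserves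
contractions. -/
theorem norm_lower_raise (h : ∀ x, ‖S (L x)‖ ≤ ‖x‖) (n : ℕ) (u : (tensorPow E π n).X) :
    ‖(lower π S hS n).1 ((raise π L hL n).1 u)‖ ≤ ‖u‖ := by
  induction n with
  | zero => exact norm_amp_amp_le π (tensorRep π) L hL S hS h u
  | succ n ih =>
    exact norm_amp_amp_le (tensorPow E π n).π (tensorPow E π (n + 1)).π
      (raise π L hL n).1 (raise π L hL n).2 (lower π S hS n).1 (lower π S hS n).2 ih u

theorem lower_concave
    (hc : ∀ u : HTensor E (tensorRep (E := E) π),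
      ‖S (amp (tensorRep π) π S hS u)‖ ^ 2 + ‖u‖ ^ 2 ≤ 2 * ‖amp (tensorRep π) π S hS u‖ ^ 2)
    (n : ℕ) (u : (tensorPow E π (n + 2)).X) :
    ‖(lower π S hS n).1 ((lower π S hS (n + 1)).1 u)‖ ^ 2 + ‖u‖ ^ 2 ≤
      2 * ‖(lower π S hS (n + 1)).1 u‖ ^ 2 := by
  induction n with
  | zero =>
    exact amp_amp_concave (tensorPow E π 1).π (tensorPow E π 0).π π
      (lower π S hS 0).1 (lower π S hS 0).2 S hS hc u
  | succ n ih =>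
    exact amp_amp_concave (tensorPow E π (n + 2)).π (tensorPow E π (n + 1)).π (tensorPow E π n).π
      (lower π S hS (n + 1)).1 (lower π S hS (n + 1)).2 (lower π S hS n).1 (lower π S hS n).2 ih u

/-- By concavity the increments of the squared norm do not increase as `S` is applied at successive
tensor factors from the inside out, so each is at most the first one. The vector `u` has `n + 2`
tensor factors, whence the coefficient. -/
theorem norm_iter_sq_le
    (hc : ∀ u : HTensor E (tensorRep (E := E) π),
      ‖S (amp (tensorRep π) π S hS u)‖ ^ 2 + ‖u‖ ^ 2 ≤ 2 * ‖amp (tensorRep π) π S hS u‖ ^ 2)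
    (n : ℕ) (u : (tensorPow E π (n + 1)).X) :
    ‖(iter π S hS (n + 1)).1 u‖ ^ 2 ≤
      ‖u‖ ^ 2 + (n + 2) * (‖(lower π S hS n).1 u‖ ^ 2 - ‖u‖ ^ 2) := by
  induction n with
  | zero =>
    have h1 := hc u
    -- With coefficient `2` the claim is concavity itself, rearranged.
    have h2 : ∀ a b c : ℝ, a + c ≤ 2 * b → a ≤ c + ((0 : ℕ) + 2) * (b - c) := by
      intro a b c h; push_cast; linarith
    exact h2 _ _ _ h1
  | succ n ih =>
    have h1 := ih ((lower π S hS (n + 1)).1 u)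
    have h2 := lower_concave π S hS hc n u
    rw [iter_lower] at h1
    push_cast
    have h3 : (0 : ℝ) ≤ n + 2 := by positivity
    nlinarith [mul_le_mul_of_nonneg_left h2 h3]

/-- `(I ⊗ ⋯ ⊗ I ⊗ L) ⋯ (I ⊗ L) L : X → E^{⊗(n+1)} ⊗ X`. -/
noncomputable def lift : (n : ℕ) → X → (tensorPow E π n).X
  | 0 => fun x => L x
  | n + 1 => fun x => (raise π L hL n).1 (lift n x)

/-- On elementary tensors the difference is a word in the maps `S (ξ ⊗ ·)` applied to some `x - S (L
x)`, which lies in `V`; linearity and closedness of `V` give the rest. -/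
theorem iter_sub_mem {V : Submodule ℂ X} (hV : IsClosed (V : Set X))
    (hVS : ∀ ξ : E, ∀ x ∈ V, S (tmul π ξ x) ∈ V) (hVL : ∀ x, x - S (L x) ∈ V)
    (n : ℕ) (u : (tensorPow E π n).X) :
    (iter π S hS n).1 u - (iter π S hS (n + 1)).1 ((raise π L hL n).1 u) ∈ V := by
  induction n with
  | zero =>
    exact htensor_sub_mem π hV S
      (S ∘L amp (tensorRep π) π S hS ∘L amp π (tensorRep π) L hL)
      (fun ξ x => by
        have h1 := hVS ξ _ (hVL x)
        rw [← tmulL_apply, map_sub, map_sub, tmulL_apply, tmulL_apply] at h1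
        simp only [ContinuousLinearMap.comp_apply, amp_tmul]
        exact h1) u
  | succ n ih =>
    exact htensor_sub_mem (tensorPow E π n).π hV
      (S ∘L amp (tensorPow E π n).π π (iter π S hS n).1 (iter π S hS n).2)
      (S ∘L amp (tensorPow E π (n + 1)).π π (iter π S hS (n + 1)).1 (iter π S hS (n + 1)).2 ∘L
        amp (tensorPow E π n).π (tensorPow E π (n + 1)).π (raise π L hL n).1 (raise π L hL n).2)
      (fun ξ z => by
        have h1 := hVS ξ _ (ih z)
        rw [← tmulL_apply, map_sub, map_sub, tmulL_apply, tmulL_apply] at h1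
        simp only [ContinuousLinearMap.comp_apply, amp_tmul]
        exact h1) u

theorem sub_iter_lift_mem {V : Submodule ℂ X} (hV : IsClosed (V : Set X))
    (hVS : ∀ ξ : E, ∀ x ∈ V, S (tmul π ξ x) ∈ V) (hVL : ∀ x, x - S (L x) ∈ V)
    (n : ℕ) (x : X) : x - (iter π S hS n).1 (lift π L hL n x) ∈ V := by
  induction n with
  | zero => exact hVL x
  | succ n ih =>
    have h1 := V.add_mem ih (iter_sub_mem π S hS L hL hV hVS hVL n (lift π L hL n x))
    rwa [sub_add_sub_cancel] at h1

/-- The vectors `S_n L_n x` are bounded along a subsequence. -/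
theorem exists_iter_lift_bounded (h : ∀ u, ‖u‖ ≤ ‖S u‖)
    (hc : ∀ u : HTensor E (tensorRep (E := E) π),
      ‖S (amp (tensorRep π) π S hS u)‖ ^ 2 + ‖u‖ ^ 2 ≤ 2 * ‖amp (tensorRep π) π S hS u‖ ^ 2)
    (hSL : ∀ x, ‖S (L x)‖ ≤ ‖x‖) (x : X) (m : ℕ) :
    ∃ n, m ≤ n ∧ ‖(iter π S hS n).1 (lift π L hL n x)‖ ^ 2 ≤ ‖x‖ ^ 2 + 1 := by
  set l : (n : ℕ) → (tensorPow E π n).X := fun n => lift π L hL n x with hl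
  -- `d n` is the gain of the innermost `S` on `l (n + 1)`. It is nonnegative by expansivity and at
  -- most `‖l n‖² - ‖l (n + 1)‖²` by `norm_lower_raise`, so the series telescopes.
  set d : ℕ → ℝ := fun n => ‖(lower π S hS n).1 (l (n + 1))‖ ^ 2 - ‖l (n + 1)‖ ^ 2 with hd
  have hd0 : ∀ n, 0 ≤ d n := fun n =>
    sub_nonneg.mpr (pow_le_pow_left₀ (norm_nonneg _) (norm_le_lower π S hS h n _) 2)
  have hl0 : ‖l 0‖ ^ 2 ≤ ‖x‖ ^ 2 :=
    pow_le_pow_left₀ (norm_nonneg _) ((h (L x)).trans (hSL x)) 2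
  have hstep : ∀ n, ‖l (n + 1)‖ ^ 2 + d n ≤ ‖l n‖ ^ 2 := by
    intro n
    have := pow_le_pow_left₀ (norm_nonneg _)
      (norm_lower_raise π S hS L hL hSL n (l n)) 2
    rw [hd, add_sub_cancel]
    exact this
  have hsum : ∀ n, ‖l n‖ ^ 2 + ∑ i ∈ Finset.range n, d i ≤ ‖x‖ ^ 2 := by
    intro n
    induction n with
    | zero => simpa using hl0
    | succ n ih =>
      rw [Finset.sum_range_succ]
      linarith [hstep n]
  have hsummable : Summable d := summable_of_sum_range_le hd0 (c := ‖x‖ ^ 2) fun n => by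
    linarith [hsum n, sq_nonneg ‖l n‖]
  by_contra! hcon
  -- If all late iterates exceed the bound, `norm_iter_sq_le` forces `(n + 2) * d n > 1`, against
  -- summability of `d`.
  have hlow : ∀ n, m ≤ n → 1 / ((n : ℝ) + 2) ≤ d n := by
    intro n hn
    have h1 := hcon (n + 1) (by omega)
    have h2 := norm_iter_sq_le π S hS hc n (l (n + 1))
    have h3 : ‖l (n + 1)‖ ^ 2 ≤ ‖x‖ ^ 2 := by
      linarith [hsum (n + 1), Finset.sum_nonneg fun i (_ : i ∈ Finset.range (n + 1)) => hd0 i]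
    rw [div_le_iff₀ (by positivity)]
    have h4 : (‖x‖ ^ 2 + 1 : ℝ) < ‖l (n + 1)‖ ^ 2 + (n + 2) * d n := h1.trans_le h2
    linarith
  have hns : ¬ Summable fun n : ℕ => 1 / ((n : ℝ)) := Real.not_summable_one_div_natCast
  apply hns
  rw [← summable_nat_add_iff (m + 2)]
  refine Summable.of_nonneg_of_le (fun n => by positivity) (fun n => ?_)
    ((summable_nat_add_iff m).mpr hsummable)
  have := hlow (n + m) (by omega)
  refine le_trans (le_of_eq ?_) this
  push_cast
  ring

/-- If `S : E ⊗_π X → X` is concave and analytic, then a closed subspace that contains `ker S⋆` and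
is invariant under the maps `x ↦ S (ξ ⊗ x)` is everything. -/
theorem eq_top_of_ker_adjoint_le (hE : InnerEssential M E)
    (hc : ∀ u : HTensor E (tensorRep (E := E) π),
      ‖S (amp (tensorRep π) π S hS u)‖ ^ 2 + ‖u‖ ^ 2 ≤ 2 * ‖amp (tensorRep π) π S hS u‖ ^ 2)
    (ha : ⨅ n : ℕ, ((iter π S hS n).1).range = ⊥)
    {V : Submodule ℂ X} (hV : IsClosed (V : Set X))
    (hVS : ∀ ξ : E, ∀ x ∈ V, S (tmul π ξ x) ∈ V)
    (hVK : (ContinuousLinearMap.adjoint S).ker ≤ V) : V = ⊤ := by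
  have hexp := norm_le_of_concave π S hS hE hc
  obtain ⟨L, hL, hSL, hLker⟩ := exists_leftInverse π S hS hexp
  have : CompleteSpace V := hV.completeSpace_coe
  rw [← Submodule.orthogonal_eq_bot_iff, Submodule.eq_bot_iff]
  intro x hx
  set Rg : ℕ → Submodule ℂ X := fun n => ((iter π S hS n).1).range with hRg
  -- Expansive iterates have closed range, so each range equals its double orthogonal complement;
  -- `hdense` relies on this.
  have hclosed : ∀ n, IsClosed (Rg n : Set X) := by
    intro n
    have hal : AntilipschitzWith 1 (iter π S hS n).1 :=
      AddMonoidHomClass.antilipschitz_of_bound _ fun u => by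
        simpa using norm_le_iter π S hS hexp n u
    have := hal.isClosed_range (iter π S hS n).1.uniformContinuous
    rwa [show Set.range (iter π S hS n).1 = (Rg n : Set X) from rfl] at this
  have hanti : Antitone Rg := antitone_nat_of_succ_le fun n => by
    rintro _ ⟨u, rfl⟩
    exact ⟨(lower π S hS n).1 u, iter_lower π S hS n u⟩
  have hdense : (⨆ n, (Rg n)ᗮ).topologicalClosure = ⊤ := by
    rw [Submodule.topologicalClosure_eq_top_iff, ← Submodule.iInf_orthogonal, ← ha]
    refine iInf_congr fun n => ?_
    have : CompleteSpace (Rg n) := (hclosed n).completeSpace_coe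
    exact Submodule.orthogonal_orthogonal _
  have hmono : Monotone fun n => (Rg n)ᗮ := fun a b hab => Submodule.orthogonal_le (hanti hab)
  have hxx : ∀ n, ⟪x, (iter π S hS n).1 (lift π L hL n x)⟫_ℂ = (‖x‖ : ℂ) ^ 2 := by
    intro n
    have h1 := (Submodule.mem_orthogonal' _ _).mp hx _ (sub_iter_lift_mem π S hS L hL hV hVS
      (fun x => hVK (hLker x)) n x)
    rw [inner_sub_right, sub_eq_zero, inner_self_eq_norm_sq_to_K] at h1
    exact h1.symm
  have hbound : ∀ y ∈ ⨆ n, (Rg n)ᗮ, ‖x‖ ^ 2 ≤ ‖x - y‖ * √(‖x‖ ^ 2 + 1) := by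
    intro y hy
    -- The complements increase, so `y` is orthogonal to the range of every later iterate, in
    -- particular of the one at which the norm bound holds.
    obtain ⟨m, hm⟩ := (Submodule.mem_iSup_of_directed _ hmono.directed_le).mp hy
    obtain ⟨n, hmn, hn⟩ := exists_iter_lift_bounded π S hS L hL hexp hc hSL x m
    have hyn : ⟪y, (iter π S hS n).1 (lift π L hL n x)⟫_ℂ = 0 :=
      (Submodule.mem_orthogonal' _ _).mp (hmono hmn hm) _ ⟨_, rfl⟩
    have h1 : ⟪x - y, (iter π S hS n).1 (lift π L hL n x)⟫_ℂ = (‖x‖ : ℂ) ^ 2 := by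
      rw [inner_sub_left, hyn, sub_zero, hxx]
    have h2 := norm_inner_le_norm (𝕜 := ℂ) (x - y) ((iter π S hS n).1 (lift π L hL n x))
    rw [h1, norm_pow, Complex.norm_real, norm_norm] at h2
    refine h2.trans ?_
    gcongr
    exact Real.le_sqrt_of_sq_le hn
  have hall : ∀ y : X, ‖x‖ ^ 2 ≤ ‖x - y‖ * √(‖x‖ ^ 2 + 1) := by
    intro y
    have hcl : IsClosed {y : X | ‖x‖ ^ 2 ≤ ‖x - y‖ * √(‖x‖ ^ 2 + 1)} :=
      isClosed_le continuous_const (by fun_prop)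
    have hy : y ∈ (⨆ n, (Rg n)ᗮ).topologicalClosure := hdense ▸ Submodule.mem_top
    exact closure_minimal (fun z hz => hbound z hz) hcl hy
  -- Density now permits the choice `y = x`.
  have h1 := hall x
  rw [sub_self, norm_zero, zero_mul] at h1
  simpa using le_antisymm h1 (sq_nonneg _)

end Wold

/-! ### Words in `T`, the generated subspace and the defect space. -/

section Restriction

variable {M : Type w} [NonUnitalCStarAlgebra M] [PartialOrder M] [StarOrderedRing M]
  {E : Type u} [NormedAddCommGroup E] [NormedSpace ℂ E] [SMul Mᵐᵒᵖ E] [CStarModule Mᵐᵒᵖ E]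
  [Correspondence M E]
  {H : Type v} [NormedAddCommGroup H] [InnerProductSpace ℂ H] [CompleteSpace H]

namespace CovRep

section Words

variable (R : CovRep M E H)

theorem word_mem {K : Submodule ℂ H} (hT : ∀ ξ, ∀ h ∈ K, R.T ξ h ∈ K) (l : List E) {h : H}
    (hh : h ∈ K) : (l.map fun ξ => R.T ξ).prod h ∈ K := by
  induction l with
  | nil => simpa using hh
  | cons ξ l ih => simpa using hT ξ _ ih

theorem ofFn_eq_map {n : ℕ} (ξ : Fin n → E) :
    (List.ofFn fun i => R.T (ξ i)) = (List.ofFn ξ).map fun ξ => R.T ξ := by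
  rw [List.map_ofFn]; rfl

theorem wordSpan_le {K : Submodule ℂ H} (hK : R.IsInvariant K) {W : Submodule ℂ H} (hW : W ≤ K)
    (n : ℕ) : R.wordSpan n W ≤ K := by
  refine Submodule.topologicalClosure_minimal _ (Submodule.span_le.mpr ?_) hK.isClosed
  rintro _ ⟨ξ, h, hh, rfl⟩
  rw [ofFn_eq_map]
  exact R.word_mem hK.T_mem _ (hW hh)

theorem generated_le {K : Submodule ℂ H} (hK : R.IsInvariant K) {W : Submodule ℂ H} (hW : W ≤ K) :
    R.generated W ≤ K :=
  Submodule.topologicalClosure_minimal _ (iSup_le fun n => R.wordSpan_le hK hW n) hK.isClosed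

theorem wordSpan_le_generated (W : Submodule ℂ H) (n : ℕ) : R.wordSpan n W ≤ R.generated W :=
  (le_iSup (fun n => R.wordSpan n W) n).trans (Submodule.le_topologicalClosure _)

theorem le_generated (W : Submodule ℂ H) : W ≤ R.generated W := fun h hh =>
  R.wordSpan_le_generated W 0
    (Submodule.le_topologicalClosure _ (Submodule.subset_span ⟨Fin.elim0, h, hh, by simp⟩))

theorem wordSpan_le_comap (W : Submodule ℂ H) (n : ℕ) (ξ : E) :
    R.wordSpan n W ≤ (R.wordSpan (n + 1) W).comap (R.T ξ : H →ₗ[ℂ] H) := by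
  refine Submodule.topologicalClosure_minimal _ (Submodule.span_le.mpr ?_)
    ((Submodule.isClosed_topologicalClosure _).preimage (R.T ξ).continuous)
  rintro _ ⟨ζ, h, hh, rfl⟩
  refine Submodule.le_topologicalClosure _ (Submodule.subset_span
    ⟨(Fin.cons ξ ζ : Fin (n + 1) → E), h, hh, ?_⟩)
  simp [List.ofFn_succ]

theorem T_mem_generated (W : Submodule ℂ H) (ξ : E) {h : H} (hh : h ∈ R.generated W) :
    R.T ξ h ∈ R.generated W := by
  have h1 : R.generated W ≤ (R.generated W).comap (R.T ξ : H →ₗ[ℂ] H) :=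
    Submodule.topologicalClosure_minimal _
      (iSup_le fun n => (R.wordSpan_le_comap W n ξ).trans
        (Submodule.comap_mono (R.wordSpan_le_generated W (n + 1))))
      ((Submodule.isClosed_topologicalClosure _).preimage (R.T ξ).continuous)
  exact h1 hh

theorem tmul_mem_tensorSub {K : Submodule ℂ H} (ξ : E) {h : H} (hh : h ∈ K) :
    tmul R.σ ξ h ∈ R.tensorSub K :=
  Submodule.le_topologicalClosure _ (Submodule.subset_span ⟨ξ, h, hh, rfl⟩)

/-- By linearity and continuity of `u ↦ ⟪x, T̃ u⟫`, orthogonality to `T̃(E ⊗ K)` need only be tested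
on the vectors `T(ξ) h`. -/
theorem mem_defect_iff {K : Submodule ℂ H} {x : H} :
    x ∈ R.defect K ↔ x ∈ K ∧ ∀ ξ, ∀ h ∈ K, ⟪x, R.T ξ h⟫_ℂ = 0 := by
  rw [defect, Submodule.mem_inf, Submodule.mem_orthogonal']
  refine and_congr_right fun _ => ⟨fun h ξ k hk => ?_, fun h => ?_⟩
  · rw [← R.tilde_tmul]
    exact h _ ⟨_, R.tmul_mem_tensorSub ξ hk, rfl⟩
  · rintro _ ⟨u, hu, rfl⟩
    have h1 : R.tensorSub K ≤ ((innerSL ℂ x) ∘L R.tilde).ker := by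
      refine Submodule.topologicalClosure_minimal _ (Submodule.span_le.mpr ?_)
        ((innerSL ℂ x) ∘L R.tilde).isClosed_ker
      rintro _ ⟨ξ, k, hk, rfl⟩
      change ⟪x, R.tilde _⟫_ℂ = 0
      rw [R.tilde_tmul]
      exact h ξ k hk
    exact h1 hu

/-- The tail of a nonempty word keeps `K` in `K`, so its leftmost letter lands in `T(ξ) K`, which is
orthogonal to the defect space. Neither concavity nor analyticity enters. -/
theorem isWandering_defect {K : Submodule ℂ H} (hK : R.IsInvariant K) :
    R.IsWandering (R.defect K) where
  isClosed := hK.isClosed.inter (Submodule.isClosed_orthogonal _)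
  σ_mem a h hh := by
    rw [mem_defect_iff] at hh ⊢
    refine ⟨hK.σ_mem a h hh.1, fun ξ k hk => ?_⟩
    -- Moving `σ(a)` across the inner product turns `T(ξ)` into `T(φ(a⋆) ξ)`.
    rw [inner_rep_left, ← mul_apply_eq_comp, ← R.T_left]
    exact hh.2 _ k hk
  isOrtho n hn := by
    obtain ⟨n, rfl⟩ := Nat.exists_eq_add_of_le' hn
    rw [Submodule.isOrtho_comm, Submodule.IsOrtho]
    refine Submodule.topologicalClosure_minimal _ (Submodule.span_le.mpr ?_)
      (Submodule.isClosed_orthogonal _)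
    rintro _ ⟨ξ, h, hh, rfl⟩
    refine (Submodule.mem_orthogonal _ _).mpr fun x hx => ?_
    rw [List.ofFn_succ, List.prod_cons, R.ofFn_eq_map fun i => ξ i.succ, mul_apply_eq_comp]
    exact ((R.mem_defect_iff).mp hx).2 _ _
      (R.word_mem hK.T_mem _ ((R.mem_defect_iff).mp hh).1)

theorem isInvariant_top : R.IsInvariant ⊤ :=
  ⟨isClosed_univ, fun _ _ _ => Submodule.mem_top, fun _ _ _ => Submodule.mem_top⟩

theorem defect_top : R.defect ⊤ = R.kerAdjoint := by
  ext x
  rw [mem_defect_iff]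
  constructor
  · rintro ⟨-, h⟩
    refine ext_inner_right ℂ fun u => ?_
    have h1 : u ∈ ((innerSL ℂ x) ∘L R.tilde).ker :=
      htensor_mem R.σ ((innerSL ℂ x) ∘L R.tilde).isClosed_ker (fun ξ k => by
        change ⟪x, R.tilde _⟫_ℂ = 0
        rw [R.tilde_tmul]
        exact h ξ k Submodule.mem_top) u
    change ⟪ContinuousLinearMap.adjoint R.tilde x, u⟫_ℂ = _
    rw [ContinuousLinearMap.adjoint_inner_left, inner_zero_left]
    exact h1
  · intro h
    have h' : ContinuousLinearMap.adjoint R.tilde x = 0 := h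
    refine ⟨Submodule.mem_top, fun ξ k _ => ?_⟩
    rw [← R.tilde_tmul, ← ContinuousLinearMap.adjoint_inner_left, h', inner_zero_left]

end Words

/-! ### Restriction of the representation to an invariant subspace. -/

variable {R : CovRep M E H} {K : Submodule ℂ H} [CompleteSpace K] (hK : R.IsInvariant K)

/-- The restriction of `σ` to an invariant subspace. -/
noncomputable def resRep : M →⋆ₙₐ[ℂ] (K →L[ℂ] K) where
  toFun a := (R.σ a ∘L K.subtypeL).codRestrict K fun x => hK.σ_mem a x x.2
  map_smul' c a := by ext; simp; rfl
  map_zero' := by ext; simp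
  map_add' a b := by ext; simp; rfl
  map_mul' a b := by ext; simp; rfl
  map_star' a := by
    rw [ContinuousLinearMap.star_eq_adjoint, ContinuousLinearMap.eq_adjoint_iff]
    intro x y
    change ⟪R.σ (star a) x, (y : H)⟫_ℂ = ⟪(x : H), R.σ a y⟫_ℂ
    rw [inner_rep_left, star_star]

theorem subtypeL_intertwines (a : M) (x : K) : K.subtypeL (resRep hK a x) = R.σ a (K.subtypeL x) :=
  rfl

/-- The isometric embedding of `E ⊗ K` into `E ⊗_σ H`. -/
noncomputable def resIncl : HTensor E (resRep hK) →L[ℂ] HTensor E R.σ :=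
  amp (resRep hK) R.σ K.subtypeL (subtypeL_intertwines hK)

theorem norm_resIncl (u : HTensor E (resRep hK)) : ‖resIncl hK u‖ = ‖u‖ :=
  le_antisymm (norm_amp_le _ _ _ _ (fun _ => le_rfl) u) (le_norm_amp _ _ _ _ (fun _ => le_rfl) u)

theorem resIncl_intertwines (a : M) (u : HTensor E (resRep hK)) :
    resIncl hK (tensorRep (resRep hK) a u) = tensorRep R.σ a (resIncl hK u) :=
  amp_tensorRep _ _ _ _ a u

/-- The restriction `E ⊗ K → K` of `T̃`. -/
noncomputable def resTilde : HTensor E (resRep hK) →L[ℂ] K :=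
  (R.tilde ∘L resIncl hK).codRestrict K fun u =>
    htensor_mem (resRep hK)
      (V := K.comap ((R.tilde ∘L resIncl hK : _ →L[ℂ] H) : HTensor E (resRep hK) →ₗ[ℂ] H))
      (hK.isClosed.preimage (R.tilde ∘L resIncl hK).continuous)
      (fun ξ x => by
        change R.tilde (amp _ _ _ _ (tmul (resRep hK) ξ x)) ∈ K
        rw [amp_tmul, tilde_tmul]
        exact hK.T_mem ξ x x.2) u

theorem coe_resTilde (u : HTensor E (resRep hK)) :
    (resTilde hK u : H) = R.tilde (resIncl hK u) := rfl

theorem coe_resTilde_tmul (ξ : E) (x : K) :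
    (resTilde hK (tmul (resRep hK) ξ x) : H) = R.T ξ x := by
  rw [coe_resTilde, resIncl, amp_tmul, tilde_tmul]; rfl

theorem resTilde_intertwines (a : M) (u : HTensor E (resRep hK)) :
    resTilde hK (tensorRep (resRep hK) a u) = resRep hK a (resTilde hK u) := by
  apply Subtype.ext
  rw [coe_resTilde, resIncl_intertwines, tilde_intertwines]
  rfl

/-- A commuting square over the inclusion `K ⊆ H` stays commuting after tensoring with `E`. It
serves both the transfer of concavity and the comparison of iterates. -/
theorem resIncl_amp {Y : Type*} [NormedAddCommGroup Y] [InnerProductSpace ℂ Y] [CompleteSpace Y]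
    (ρ : M →⋆ₙₐ[ℂ] (Y →L[ℂ] Y)) (S : Y →L[ℂ] K) (hS : ∀ a x, S (ρ a x) = resRep hK a (S x))
    {Z : Type*} [NormedAddCommGroup Z] [InnerProductSpace ℂ Z] [CompleteSpace Z]
    (τ : M →⋆ₙₐ[ℂ] (Z →L[ℂ] Z)) (J : Y →L[ℂ] Z) (hJ : ∀ a x, J (ρ a x) = τ a (J x))
    (S' : Z →L[ℂ] H) (hS' : ∀ a x, S' (τ a x) = R.σ a (S' x))
    (h : ∀ y, (S y : H) = S' (J y)) (u : HTensor E ρ) :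
    resIncl hK (amp ρ (resRep hK) S hS u) = amp τ R.σ S' hS' (amp ρ τ J hJ u) := by
  have hC : ∀ a x, (S' ∘L J) (ρ a x) = R.σ a ((S' ∘L J) x) := fun a x => by simp [hJ, hS']
  rw [resIncl, amp_comp ρ (resRep hK) R.σ S hS _ _ (S' ∘L J) hC h,
    amp_comp ρ τ R.σ J hJ S' hS' (S' ∘L J) hC fun _ => rfl]

theorem resTilde_concave (hc : R.IsConcave) (u : HTensor E (tensorRep (E := E) (resRep hK))) :
    ‖resTilde hK (amp (tensorRep (resRep hK)) (resRep hK) (resTilde hK)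
      (resTilde_intertwines hK) u)‖ ^ 2 + ‖u‖ ^ 2 ≤
    2 * ‖amp (tensorRep (resRep hK)) (resRep hK) (resTilde hK) (resTilde_intertwines hK) u‖ ^ 2 := by
  set j := amp (E := E) (tensorRep (resRep hK)) (tensorRep R.σ) (resIncl hK)
    (resIncl_intertwines hK)
  have hj : ‖j u‖ = ‖u‖ :=
    le_antisymm (norm_amp_le _ _ _ _ (fun x => (norm_resIncl hK x).le) u)
      (le_norm_amp _ _ _ _ (fun x => (norm_resIncl hK x).ge) u)
  have h1 := resIncl_amp hK (tensorRep (resRep hK)) (resTilde hK) (resTilde_intertwines hK)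
    (tensorRep R.σ) (resIncl hK) (resIncl_intertwines hK) R.tilde R.tilde_intertwines
    (fun _ => rfl) u
  have h2 := hc (j u)
  rw [hj] at h2
  rw [← norm_resIncl hK (amp _ _ _ _ u), Submodule.coe_norm, coe_resTilde, h1]
  exact h2

/-- Analyticity of the restriction needs only that the range of each restricted iterate sits inside
that of `T̃_{n+1}`, so the existence of some intertwining `J` suffices. -/
theorem exists_iter_eq (n : ℕ) :
    ∃ J : (tensorPow E (resRep hK) n).X →L[ℂ] (tensorPow E R.σ n).X,
      (∀ a x, J ((tensorPow E (resRep hK) n).π a x) = (tensorPow E R.σ n).π a (J x)) ∧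
      ∀ u, ((iter (resRep hK) (resTilde hK) (resTilde_intertwines hK) n).1 u : H) =
        R.tildePow n (J u) := by
  induction n with
  | zero => exact ⟨resIncl hK, resIncl_intertwines hK, fun _ => rfl⟩
  | succ n ih =>
    obtain ⟨J, hJ, h⟩ := ih
    refine ⟨amp _ _ J hJ, amp_tensorRep _ _ J hJ, fun u => ?_⟩
    exact congrArg R.tilde (resIncl_amp hK (tensorPow E (resRep hK) n).π
      (iter (resRep hK) (resTilde hK) (resTilde_intertwines hK) n).1
      (iter (resRep hK) (resTilde hK) (resTilde_intertwines hK) n).2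
      (tensorPow E R.σ n).π J hJ (R.tildePowAux n).1 (R.tildePowAux n).2 h u)

theorem iInf_range_iter (ha : R.IsAnalytic) :
    ⨅ n : ℕ, ((iter (resRep hK) (resTilde hK) (resTilde_intertwines hK) n).1).range = ⊥ := by
  rw [Submodule.eq_bot_iff]
  intro x hx
  rw [Submodule.mem_iInf] at hx
  have h1 : (x : H) ∈ ⨅ n : ℕ, (R.tildePow n).range := by
    rw [Submodule.mem_iInf]
    intro n
    obtain ⟨u, rfl⟩ := hx n
    obtain ⟨J, -, h⟩ := exists_iter_eq hK n
    exact ⟨J u, (h u).symm⟩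
  rw [show _ = _ from ha] at h1
  exact Subtype.ext h1

theorem eq_generated_defect (hK : R.IsInvariant K) (hE : InnerEssential M E) (ha : R.IsAnalytic) (hc : R.IsConcave) :
    K = R.generated (R.defect K) := by
  refine le_antisymm (fun x hx => ?_) (R.generated_le hK inf_le_left)
  -- The Wold argument is run inside `K` with `V` the trace of the generated subspace; the kernel of
  -- the adjoint of the restricted operator lies in the defect space of `K`.
  have h1 : (R.generated (R.defect K)).comap K.subtype = ⊤ := by
    refine eq_top_of_ker_adjoint_le (resRep hK) (resTilde hK) (resTilde_intertwines hK) hE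
      (resTilde_concave hK hc) (iInf_range_iter hK ha)
      ((Submodule.isClosed_topologicalClosure _).preimage continuous_subtype_val) ?_ ?_
    · intro ξ y hy
      change (resTilde hK (tmul (resRep hK) ξ y) : H) ∈ R.generated (R.defect K)
      rw [coe_resTilde_tmul]
      exact R.T_mem_generated _ ξ hy
    · intro y hy
      have hy' : ContinuousLinearMap.adjoint (resTilde hK) y = 0 := hy
      refine R.le_generated _ (R.mem_defect_iff.mpr ⟨y.2, fun ξ h hh => ?_⟩)
      rw [← coe_resTilde_tmul hK ξ ⟨h, hh⟩]
      change ⟪y, resTilde hK _⟫_ℂ = 0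
      rw [← ContinuousLinearMap.adjoint_inner_left, hy', inner_zero_left]
  have h2 : (⟨x, hx⟩ : K) ∈ (R.generated (R.defect K)).comap K.subtype := h1 ▸ Submodule.mem_top
  exact h2

end CovRep

end Restriction

end CStarCorr

theorem theorem2p4 {M E H : Type*}
    [NonUnitalCStarAlgebra M] [PartialOrder M] [StarOrderedRing M]
    [NormedAddCommGroup E] [NormedSpace ℂ E] [CompleteSpace E]
    [SMul Mᵐᵒᵖ E] [CStarModule Mᵐᵒᵖ E] [CStarCorr.Correspondence M E]
    [NormedAddCommGroup H] [InnerProductSpace ℂ H] [CompleteSpace H]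
    (hE : CStarCorr.InnerEssential M E)
    (R : CStarCorr.CovRep M E H) (hanalytic : R.IsAnalytic) (hconcave : R.IsConcave) :
    (∀ K : Submodule ℂ H, R.IsInvariant K →
      R.IsWandering (R.defect K) ∧ K = R.generated (R.defect K)) ∧
    R.HasGeneratingWanderingSubspace := by
  have main : ∀ K : Submodule ℂ H, R.IsInvariant K →
      R.IsWandering (R.defect K) ∧ K = R.generated (R.defect K) := fun K hK => by
    have : CompleteSpace K := hK.isClosed.completeSpace_coe
    exact ⟨R.isWandering_defect hK,
      CStarCorr.CovRep.eq_generated_defect hK hE hanalytic hconcave⟩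
  obtain ⟨h1, h2⟩ := main ⊤ R.isInvariant_top
  rw [R.defect_top] at h1 h2
  exact ⟨main, h1, h2.symm⟩
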